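/- Let $\mathbb D$ be the open unit disk in $\mathbb C$, $L^2(\mathbb D)$ the space with respect to the area measure, $\partial=\frac12(\partial_x-i\partial_y)$, $\bar\partial=\frac12(\partial_x+i\partial_y)$. For $j\ge 0$ let $\mathcal A_j(\mathbb D)=\{f\in L^2(\mathbb D):\bar\partial^j f=0\}$, $\mathcal A(\mathbb D)=\mathcal A_1(\mathbb D)$, $\mathcal A_{(j+1)}(\mathbb D)=\mathcal A_{j+1}(\mathbb D)\ominus\mathcal A_j(\mathbb D)$ and $\Sigma_j u=\partial^j\big((1-|z|^2)^j u\big)$. Let $\mathcal P$ be the space of finite linear combinations of the basis functions $\sqrt{(k+1)/\pi}\,z^k$, $k\ge0$. A symbol is a distribution $F$ on $\mathbb D$ that is defined at least on $C^\infty(\overline{\mathbb D})$, i.e. a linear functional $\varphi\mapsto(F,\varphi)$ on $C^\infty(\overline{\mathbb D})$ whose restriction to the test functions on $\mathbb D$ is continuous; derivatives of symbols and their products with functions from $C^\infty(\overline{\mathbb D})$ are defined by duality on $C^\infty(\overline{\mathbb D})$: $(\partial_xF,\varphi)=-(F,\partial_x\varphi)$, $(\partial_yF,\varphi)=-(F,\partial_y\varphi)$,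 $(aF,\varphi)=(F,a\varphi)$. The Toeplitz operator $T_F$ in $\mathcal A_{(j+1)}(\mathbb D)$ (respectively in $\mathcal A(\mathbb D)$) is called bounded if $|(F,u\bar v)|\le C\|u\|_{L^2}\|v\|_{L^2}$ for some constant $C$ and all $u,v\in\Sigma_j\mathcal P$ (respectively $u,v\in\mathcal P$); it is then the bounded operator in that space with $\langle T_Fu,v\rangle=(F,u\bar v)$ for these $u,v$. **Theorem.** For every integer $j\ge0$ there is a complex polynomial $\underline M_j$ of degree $j$ in three non-commuting variables such that the operator $$M_j=\underline M_j\big(\Delta(1-|z|^2)^2\,\cdot,\ \partial z(1-|z|^2)\,\cdot,\ \bar z\bar\partial(1-|z|^2)\,\cdot\big),$$ acting on symbols, has the following properties. 1. If differentiations are given weight $-1$ (so $\Delta$ has weight $-2$), $1-|z|^2$ weight $1$ and $z,\bar z$ weight $0$, with weights adding under multiplication, then all monomials of $\underline M_j$ have weight $0$. 2. $M_j$ is a differential operator of order $2j$ with smooth coefficients, elliptic in $\mathbb D$. 3. For every symbol $F$ and all $f,g\in\mathcal P$, $$(F,\ \Sigma_jf\,\overline{\Sigma_jg})=(M_jF,\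 f\bar g).$$ 4. For every symbol $F$, if one of the operators $T_1=T_F$ in $\mathcal A_{(j+1)}(\mathbb D)$ and $T_2=T_{M_jF}$ in $\mathcal A(\mathbb D)$ is bounded, then both are bounded (and uniquely determined by their forms), and they are cosimilar: $T_1=Z^*T_2Z$ for a bounded operator $Z:\mathcal A_{(j+1)}(\mathbb D)\to\mathcal A(\mathbb D)$ with bounded inverse. In this case $T_1$ is compact if and only if $T_2$ is; for each $0<p<\infty$, $T_1$ belongs to the Schatten class $S_p$ if and only if $T_2$ does; $T_1$ has finite rank if and only if $T_2$ does; and $T_1=0$ if and only if $T_2=0$. -/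

import Mathlib

open scoped Distributions ContDiff InnerProductSpace
open MeasureTheory TopologicalSpace

namespace PolyBergman

noncomputable section

/-! ### Smooth functions and differentiation -/

/-- The algebra of smooth functions `ℂ → ℂ` (smooth in the real sense, with `ℂ = ℝ²`). -/
def Smooth : Subalgebra ℂ (ℂ → ℂ) where
  carrier := {f | ContDiff ℝ ∞ f}
  mul_mem' {f g} hf hg := show ContDiff ℝ ∞ (f * g) from
    ContDiff.mul (show ContDiff ℝ ∞ f from hf) (show ContDiff ℝ ∞ g from hg)
  add_mem' {f g} hf hg := show ContDiff ℝ ∞ (f + g) from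
    ContDiff.add (show ContDiff ℝ ∞ f from hf) (show ContDiff ℝ ∞ g from hg)
  algebraMap_mem' c := show ContDiff ℝ ∞ (fun _ => c) from contDiff_const

lemma contDiff_smooth (f : Smooth) : ContDiff ℝ ∞ (f : ℂ → ℂ) := f.2

/-- The derivative of a smooth function in the direction `v ∈ ℂ = ℝ²`. -/
def dirDeriv (v : ℂ) : Smooth →ₗ[ℂ] Smooth where
  toFun f := ⟨fun z => fderiv ℝ (f : ℂ → ℂ) z v,
    ((contDiff_smooth f).fderiv_right (m := ∞) (by norm_num)).clm_apply contDiff_const⟩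
  map_add' f g := by
    apply Subtype.ext; funext z
    have hf : DifferentiableAt ℝ (f : ℂ → ℂ) z := ((contDiff_smooth f).differentiable (by simp)) z
    have hg : DifferentiableAt ℝ (g : ℂ → ℂ) z := ((contDiff_smooth g).differentiable (by simp)) z
    change fderiv ℝ ((f : ℂ → ℂ) + (g : ℂ → ℂ)) z v = _
    rw [fderiv_add hf hg]; rfl
  map_smul' c f := by
    apply Subtype.ext; funext z
    have hf : DifferentiableAt ℝ (f : ℂ → ℂ) z := ((contDiff_smooth f).differentiable (by simp)) z
    change fderiv ℝ (c • (f : ℂ → ℂ)) z v = _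
    rw [fderiv_const_smul hf]; rfl

/-- `∂ = (∂ₓ - i ∂_y) / 2` on smooth functions. -/
def del : Smooth →ₗ[ℂ] Smooth := (1 / 2 : ℂ) • (dirDeriv 1 - Complex.I • dirDeriv Complex.I)

/-- `∂̄ = (∂ₓ + i ∂_y) / 2` on smooth functions. -/
def delbar : Smooth →ₗ[ℂ] Smooth := (1 / 2 : ℂ) • (dirDeriv 1 + Complex.I • dirDeriv Complex.I)

/-- Pointwise complex conjugation of smooth functions. -/
def conjS (f : Smooth) : Smooth :=
  ⟨fun z => star ((f : ℂ → ℂ) z), Complex.conjCLE.contDiff.comp (show ContDiff ℝ ∞ _ from f.2)⟩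

/-- The function `z`. -/
def zS : Smooth := ⟨fun z => z, show ContDiff ℝ ∞ (fun z : ℂ => z) from contDiff_id⟩

/-- The function `1 - |z|²`, written as `1 - z z̄`. -/
def rhoS : Smooth := 1 - zS * conjS zS

lemma rhoS_apply (z : ℂ) : (rhoS : ℂ → ℂ) z = 1 - (‖z‖ : ℂ) ^ 2 := by
  change (1 : ℂ) - z * star z = _
  rw [Complex.star_def, Complex.mul_conj']

/-- `Σ_j u = ∂ʲ((1 - |z|²)ʲ u)`. -/
def sigmaOp (j : ℕ) : Smooth →ₗ[ℂ] Smooth := (del ^ j) ∘ₗ LinearMap.mulLeft ℂ (rhoS ^ j)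

/-! ### Distributions on the disk that are defined on `C^∞` of the closed disk -/

/-- The open unit disk. -/
def disk : Opens ℂ := ⟨Metric.ball 0 1, Metric.isOpen_ball⟩

/-- A test function on the disk, as a smooth function. -/
def ofTest (φ : 𝓓(disk, ℂ)) : Smooth := ⟨φ, φ.contDiff⟩

/-- Distributions on the open unit disk that are defined at least on `C^∞(closed disk)`.
Elements of `C^∞(closed disk)` are restrictions of elements of `Smooth`, so such an object is a
linear functional on `Smooth` whose value depends only on the restriction of the function to the
closed disk, and which is continuous on the space of test functions of the open disk. -/
def DiskDist : Submodule ℂ (Module.Dual ℂ Smooth) where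
  carrier := {F | (∀ φ : Smooth, (∀ z ∈ Metric.closedBall (0 : ℂ) 1, (φ : ℂ → ℂ) z = 0) → F φ = 0) ∧
    Continuous fun φ : 𝓓(disk, ℂ) => F (ofTest φ)}
  add_mem' hF hG := ⟨fun φ h => by simp [hF.1 φ h, hG.1 φ h], hF.2.add hG.2⟩
  zero_mem' := ⟨fun _ _ => rfl, continuous_const⟩
  smul_mem' c F hF := ⟨fun φ h => by simp [hF.1 φ h], hF.2.const_smul c⟩

lemma dirDeriv_eq_zero (v : ℂ) (φ : Smooth)
    (h : ∀ z ∈ Metric.closedBall (0 : ℂ) 1, (φ : ℂ → ℂ) z = 0) :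
    ∀ z ∈ Metric.closedBall (0 : ℂ) 1, (dirDeriv v φ : ℂ → ℂ) z = 0 := by
  have hc : Continuous (dirDeriv v φ : ℂ → ℂ) := (contDiff_smooth _).continuous
  have hcl : IsClosed {z | (dirDeriv v φ : ℂ → ℂ) z = 0} := isClosed_eq hc continuous_const
  have hb : Metric.ball (0 : ℂ) 1 ⊆ {z | (dirDeriv v φ : ℂ → ℂ) z = 0} := by
    intro z hz
    have he : (φ : ℂ → ℂ) =ᶠ[nhds z] fun _ => 0 := by
      filter_upwards [Metric.isOpen_ball.mem_nhds hz] with w hw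
      exact h w (Metric.ball_subset_closedBall hw)
    change fderiv ℝ (φ : ℂ → ℂ) z v = 0
    rw [he.fderiv_eq]; simp
  intro z hz
  rw [← closure_ball (0 : ℂ) one_ne_zero] at hz
  exact closure_minimal hb hcl hz

lemma continuous_mul_test (a : Smooth) {F : Module.Dual ℂ Smooth}
    (hF : Continuous fun φ : 𝓓(disk, ℂ) => F (ofTest φ)) :
    Continuous fun φ : 𝓓(disk, ℂ) => F (a * ofTest φ) := by
  let L : 𝓓(disk, ℂ) →ₗ[ℂ] ℂ :=
    { toFun := fun φ => F (a * ofTest φ)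
      map_add' := fun φ ψ => by
        rw [← map_add, ← mul_add]; rfl
      map_smul' := fun c φ => by
        rw [RingHom.id_apply, ← map_smul, ← mul_smul_comm]; rfl }
  change Continuous L
  rw [TestFunction.continuous_iff_continuous_comp]
  intro K hK
  have ha : ContDiff ℝ ((⊤ : ℕ∞) : WithTop ℕ∞) (a : ℂ → ℂ) := a.2
  have h1 := (ContDiffMapSupportedIn.bilinLeftCLM (K := K) (n := (⊤ : ℕ∞))
    (ContinuousLinearMap.mul ℝ ℂ) ha).continuous
  have h2 := hF.comp ((TestFunction.continuous_ofSupportedIn (n := (⊤ : ℕ∞)) (F := ℂ) hK).comp h1)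
  refine h2.congr fun f => ?_
  change F _ = F _
  congr 1
  apply Subtype.ext; funext z
  exact mul_comm _ _

/-- The distributional derivative in the direction `v`: `(D_v F, φ) = -(F, D_v φ)`. -/
def distDeriv (v : ℂ) : Module.End ℂ DiskDist where
  toFun F := ⟨-(F : Module.Dual ℂ Smooth) ∘ₗ dirDeriv v,
    fun φ h => by
      have := F.2.1 _ (dirDeriv_eq_zero v φ h)
      simpa using this,
    by
      have h := (F.2.2.comp (TestFunction.lineDerivCLM (Ω := disk) (n := (⊤ : ℕ∞))
        (k := (⊤ : ℕ∞)) ℂ v).continuous).neg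
      refine h.congr fun φ => ?_
      change -((F : Module.Dual ℂ Smooth) (ofTest (TestFunction.lineDerivCLM ℂ v φ))) =
        -((F : Module.Dual ℂ Smooth) (dirDeriv v (ofTest φ)))
      congr 2⟩
  map_add' F G := by
    apply Subtype.ext; ext φ; simp; ring
  map_smul' c F := by
    apply Subtype.ext; ext φ; simp

/-- The product of a distribution and a smooth function: `(a F, φ) = (F, a φ)`. -/
def distMul (a : Smooth) : Module.End ℂ DiskDist where
  toFun F := ⟨(F : Module.Dual ℂ Smooth) ∘ₗ LinearMap.mulLeft ℂ a,
    fun φ h => F.2.1 _ fun z hz => by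
      change (a : ℂ → ℂ) z * (φ : ℂ → ℂ) z = 0
      rw [h z hz, mul_zero],
    continuous_mul_test a F.2.2⟩
  map_add' F G := rfl
  map_smul' c F := rfl

/-- The action `(F, φ)` of a distribution on a function of `C^∞(closed disk)`. -/
def pair (F : DiskDist) (φ : Smooth) : ℂ := (F : Module.Dual ℂ Smooth) φ

/-- `∂` on distributions. -/
def distDel : Module.End ℂ DiskDist :=
  (1 / 2 : ℂ) • (distDeriv 1 - Complex.I • distDeriv Complex.I)

/-- `∂̄` on distributions. -/
def distDelbar : Module.End ℂ DiskDist :=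
  (1 / 2 : ℂ) • (distDeriv 1 + Complex.I • distDeriv Complex.I)

/-- The Laplacian `Δ = ∂ₓ² + ∂_y²` on distributions. -/
def distLap : Module.End ℂ DiskDist := distDeriv 1 ^ 2 + distDeriv Complex.I ^ 2

/-! ### Weight zero polynomials -/

/-- The elementary operators: `Δ`, `∂`, `∂̄`, and multiplication by `z`, `z̄`, `1 - |z|²`. -/
inductive Letter
  | lap | del | delbar | z | zbar | rho

/-- Differentiations have weight `-1` (so `Δ` has weight `-2`), `1 - |z|²` has weight `1`,
and `z`, `z̄` have weight `0`. -/
def Letter.weight : Letter → ℤ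
  | .lap => -2
  | .del => -1
  | .delbar => -1
  | .z => 0
  | .zbar => 0
  | .rho => 1

/-- The operator on distributions that a letter stands for. -/
def Letter.op : Letter → Module.End ℂ DiskDist
  | .lap => distLap
  | .del => distDel
  | .delbar => distDelbar
  | .z => distMul zS
  | .zbar => distMul (conjS zS)
  | .rho => distMul rhoS

/-- The three variables of the polynomials. -/
inductive Gen
  | lapl | dz | zd

/-- The variables stand for the compositions `Δ (1-|z|²)²`, `∂ z (1-|z|²)`, `z̄ ∂̄ (1-|z|²)`;
the rightmost operator acts first. -/
def Gen.word : Gen → List Letter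
  | .lapl => [.lap, .rho, .rho]
  | .dz => [.del, .z, .rho]
  | .zd => [.zbar, .delbar, .rho]

/-- A monomial in the (non-commuting) variables, written out in letters. -/
def expand (w : List Gen) : List Letter := w.flatMap Gen.word

/-- The weight of a monomial is the sum of the weights of its letters. -/
def weight (w : List Gen) : ℤ := ((expand w).map Letter.weight).sum

/-- The operator of a monomial is the composition of the operators of its letters. -/
def monomialOp (w : List Gen) : Module.End ℂ DiskDist := ((expand w).map Letter.op).prod

/-- Complex polynomials in the three non-commuting variables. -/
abbrev NCPoly := List Gen →₀ ℂ

/-- The polynomial has degree exactly `d`. -/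
def HasDegree (P : NCPoly) (d : ℕ) : Prop :=
  (∀ w ∈ P.support, w.length ≤ d) ∧ ∃ w ∈ P.support, w.length = d

/-- The operator obtained by substituting the three operators for the variables. -/
def evalOp (P : NCPoly) : Module.End ℂ DiskDist := P.sum fun w c => c • monomialOp w

/-! ### Ellipticity -/

/-- `L = ∑_{k+l≤m} a_{kl} ∂ᵏ ∂̄ˡ` with smooth coefficients, and its principal symbol (the symbols
of `∂`, `∂̄` at the covector `ξ = ξ₁ + i ξ₂` are `i(ξ₁ - iξ₂)/2`, `i(ξ₁ + iξ₂)/2`) vanishes at no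
point of the open disk and no `ξ ≠ 0`. -/
def IsEllipticOfOrder (m : ℕ) (L : Module.End ℂ DiskDist) : Prop :=
  ∃ a : ℕ → ℕ → Smooth,
    L = ∑ k ∈ Finset.range (m + 1), ∑ l ∈ Finset.range (m + 1 - k),
      distMul (a k l) * distDel ^ k * distDelbar ^ l ∧
    ∀ z ∈ Metric.ball (0 : ℂ) 1, ∀ ξ : ℂ, ξ ≠ 0 →
      ∑ k ∈ Finset.range (m + 1), (a k (m - k) : ℂ → ℂ) z *
        (Complex.I * star ξ / 2) ^ k * (Complex.I * ξ / 2) ^ (m - k) ≠ 0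

/-! ### Polyanalytic Bergman spaces -/

/-- `L²` of the unit disk with the Lebesgue area measure. -/
abbrev L2Disk := Lp ℂ 2 ((volume : Measure ℂ).restrict (Metric.ball 0 1))

lemma memLp_smooth (f : Smooth) :
    MemLp (f : ℂ → ℂ) 2 ((volume : Measure ℂ).restrict (Metric.ball 0 1)) := by
  have hc : Continuous (f : ℂ → ℂ) := (contDiff_smooth f).continuous
  obtain ⟨C, hC⟩ := (isCompact_closedBall (0 : ℂ) 1).exists_bound_of_continuousOn hc.continuousOn
  have : IsFiniteMeasure ((volume : Measure ℂ).restrict (Metric.ball 0 1)) :=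
    ⟨by simp⟩
  refine MemLp.of_bound hc.aestronglyMeasurable C ?_
  filter_upwards [ae_restrict_mem measurableSet_ball] with z hz
  exact hC z (Metric.ball_subset_closedBall hz)

/-- The class in `L²` of the disk of a smooth function. -/
def toL2 (f : Smooth) : L2Disk := (memLp_smooth f).toLp _

/-- The poly-Bergman space `A_j`: the functions `f ∈ L²` of the disk with `∂̄ʲ f = 0`, the equation
being understood in the sense of distributions (by elliptic regularity its solutions are smooth). -/
def polyBergman (j : ℕ) : Submodule ℂ L2Disk where
  carrier := {f | ∀ φ : 𝓓(disk, ℂ),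
    ∫ z in Metric.ball (0 : ℂ) 1, f z * ((delbar ^ j) (ofTest φ) : ℂ → ℂ) z = 0}
  zero_mem' φ := by
    refine integral_eq_zero_of_ae ?_
    filter_upwards [Lp.coeFn_zero ℂ 2 ((volume : Measure ℂ).restrict (Metric.ball 0 1))] with z hz
    change (0 : L2Disk) z * _ = 0
    rw [hz, Pi.zero_apply, zero_mul]
  add_mem' {f g} hf hg φ := by
    have hi : ∀ h : L2Disk, Integrable
        (fun z => h z * ((delbar ^ j) (ofTest φ) : ℂ → ℂ) z)
        ((volume : Measure ℂ).restrict (Metric.ball 0 1)) := fun h =>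
      MemLp.integrable_mul (Lp.memLp h) (memLp_smooth _)
    refine Eq.trans ?_ ((integral_add (hi f) (hi g)).trans
      ((congrArg₂ (· + ·) (hf φ) (hg φ)).trans (add_zero _)))
    refine integral_congr_ae ?_
    filter_upwards [Lp.coeFn_add f g] with z hz
    rw [hz, Pi.add_apply, add_mul]
  smul_mem' c f hf φ := by
    refine Eq.trans ?_ ((integral_const_mul c _).trans
      ((congrArg (c * ·) (hf φ)).trans (mul_zero c)))
    refine integral_congr_ae ?_
    filter_upwards [Lp.coeFn_smul c f] with z hz
    rw [hz, Pi.smul_apply, smul_eq_mul, mul_assoc]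

lemma mem_polyBergman_iff (j : ℕ) (f : L2Disk) : f ∈ polyBergman j ↔
    ∀ φ : 𝓓(disk, ℂ), ⟪toL2 (conjS ((delbar ^ j) (ofTest φ))), f⟫_ℂ = 0 := by
  refine forall_congr' fun φ => ?_
  have h : ⟪toL2 (conjS ((delbar ^ j) (ofTest φ))), f⟫_ℂ =
      ∫ z in Metric.ball (0 : ℂ) 1, f z * ((delbar ^ j) (ofTest φ) : ℂ → ℂ) z := by
    rw [L2.inner_def]
    refine integral_congr_ae ?_
    filter_upwards [(memLp_smooth (conjS ((delbar ^ j) (ofTest φ)))).coeFn_toLp] with z hz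
    change ⟪((memLp_smooth (conjS ((delbar ^ j) (ofTest φ)))).toLp _ : L2Disk) z, f z⟫_ℂ = _
    rw [hz]
    simp [conjS]
  rw [h]

lemma isClosed_polyBergman (j : ℕ) : IsClosed (polyBergman j : Set L2Disk) := by
  have : (polyBergman j : Set L2Disk) =
      ⋂ φ : 𝓓(disk, ℂ), {f | ⟪toL2 (conjS ((delbar ^ j) (ofTest φ))), f⟫_ℂ = 0} := by
    ext f; simp [mem_polyBergman_iff]
  rw [this]
  exact isClosed_iInter fun φ => isClosed_eq (by fun_prop) continuous_const

instance (j : ℕ) : CompleteSpace (polyBergman j) :=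
  (isClosed_polyBergman j).completeSpace_coe

/-- The Bergman space `A(𝔻) = A_1(𝔻)`. -/
abbrev bergman : Submodule ℂ L2Disk := polyBergman 1

/-- The true poly-Bergman space `A_(j+1) = A_{j+1} ⊖ A_j`. -/
def trueBergmanSucc (j : ℕ) : Submodule ℂ L2Disk := polyBergman (j + 1) ⊓ (polyBergman j)ᗮ

instance (j : ℕ) : CompleteSpace (trueBergmanSucc j) :=
  IsClosed.completeSpace_coe
    (hs := (isClosed_polyBergman (j + 1)).inter (Submodule.isClosed_orthogonal _))

/-! ### Toeplitz operators -/

/-- The standard orthonormal basis `√((k+1)/π) zᵏ` of the Bergman space of the disk. -/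
def basisFn (k : ℕ) : Smooth := ((√((k + 1) / Real.pi) : ℝ) : ℂ) • zS ^ k

/-- Finite linear combinations of the standard basis functions of the Bergman space. -/
def basisSpan : Submodule ℂ Smooth := Submodule.span ℂ (Set.range basisFn)

/-- Finite linear combinations of the functions `Σ_j e`, `e` a standard basis function. -/
def sigmaSpan (j : ℕ) : Submodule ℂ Smooth := basisSpan.map (sigmaOp j)

/-- The sesquilinear form `(u, v) ↦ (F, u v̄)`, on the functions of `D`, is bounded in the
`L²`-norm: the Toeplitz operator with symbol `F` is bounded. -/
def ToeplitzBounded (D : Submodule ℂ Smooth) (F : DiskDist) : Prop :=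
  ∃ C : ℝ, ∀ u ∈ D, ∀ v ∈ D, ‖pair F (u * conjS v)‖ ≤ C * ‖toL2 u‖ * ‖toL2 v‖

/-- `T` is the Toeplitz operator with symbol `F` in the space `H`: the bounded operator with
`⟨T u, v⟩ = (F, u v̄)` for `u`, `v` in the subspace `D` of `H`
(`⟪x, y⟫_ℂ` is linear in `y`). -/
def IsToeplitz (H : Submodule ℂ L2Disk) (D : Submodule ℂ Smooth) (F : DiskDist)
    (T : H →L[ℂ] H) : Prop :=
  ∀ u ∈ D, ∀ v ∈ D, ∃ U V : H, (U : L2Disk) = toL2 u ∧ (V : L2Disk) = toL2 v ∧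
    ⟪V, T U⟫_ℂ = pair F (u * conjS v)

/-! ### Operators in Hilbert spaces -/

/-- `T₁` and `T₂` are cosimilar: `T₁ = Z* T₂ Z` with `Z` bounded and (boundedly) invertible. -/
def Cosimilar {H K : Type*} [NormedAddCommGroup H] [InnerProductSpace ℂ H] [CompleteSpace H]
    [NormedAddCommGroup K] [InnerProductSpace ℂ K] [CompleteSpace K]
    (T₁ : H →L[ℂ] H) (T₂ : K →L[ℂ] K) : Prop :=
  ∃ Z : H ≃L[ℂ] K, T₁ = ContinuousLinearMap.adjoint (Z : H →L[ℂ] K) ∘L T₂ ∘L (Z : H →L[ℂ] K)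

/-- The operator has rank at most `n`. -/
def RankLE {H : Type*} [NormedAddCommGroup H] [InnerProductSpace ℂ H]
    (R : H →L[ℂ] H) (n : ℕ) : Prop :=
  LinearMap.rank (R : H →ₗ[ℂ] H) ≤ n

/-- The `n`-th `s`-number (`n = 0, 1, …`) of a bounded operator in a Hilbert space: its distance to
the operators of rank at most `n`. -/
def sNumber {H : Type*} [NormedAddCommGroup H] [InnerProductSpace ℂ H]
    (T : H →L[ℂ] H) (n : ℕ) : ℝ :=
  ⨅ R : {R : H →L[ℂ] H // RankLE R n}, ‖T - R‖

/-- The Schatten class `S_p`, `0 < p < ∞`: the `s`-numbers are `p`-summable. -/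
def IsSchatten {H : Type*} [NormedAddCommGroup H] [InnerProductSpace ℂ H]
    (p : ℝ) (T : H →L[ℂ] H) : Prop :=
  Summable fun n => sNumber T n ^ p

/-- The operator has finite rank. -/
def IsFiniteRank {H : Type*} [NormedAddCommGroup H] [InnerProductSpace ℂ H]
    (T : H →L[ℂ] H) : Prop :=
  FiniteDimensional ℂ (LinearMap.range (T : H →ₗ[ℂ] H))

end

end PolyBergman

open PolyBergman

namespace PolyBergman

noncomputable section

/-! ### Algebra of smooth functions -/

/-! Write ρ = 1 - |z|² and Y = Δρ²/4 + ∂zρ + z̄∂̄ρ; the formal adjoint of Y is h ↦ ρ∂∂̄(ρh). For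
holomorphic f the functions Σ_j f satisfy two ladder relations: ρ∂Σ_j f = Σ_{j+1} f + (j+1) z̄ Σ_j f
and ρ∂̄Σ_j f = -j z Σ_j f - j² Σ_{j-1} f (`rho_mul_del_sigmaOp`, `rho_mul_delbar_sigmaOp`). Applying
ρ∂∂̄ρ to W_j = Σ_j f · conj(Σ_j g), all terms containing z or z̄ cancel, and W_{j+1} - ((j+1)² + j²)
W_j + j⁴ W_{j-1} remains (`adjY_sigmaOp`). By duality M_{j+1} = M_j Y + ((j+1)² + j²) M_j - j⁴
M_{j-1} with M_0 = 1, so M_j is a monic polynomial of degree j in Y. Degree and weight are read off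
this recurrence, and the leading part of M_j is ρ^{2j} ∂^j ∂̄^j, which is elliptic where ρ ≠ 0.

For the operators, both Toeplitz forms become one form (f, g) ↦ (M_j F, f ḡ) on polynomials,
transported to A_(j+1) by Σ_j and to A by inclusion. Cosimilarity then follows from two facts: the
two transported norms are equivalent, and both images are dense (`cosimilar_of_represents`); Z is
the extension of Σ_j f ↦ f.

Equivalence of norms: integration by parts gives ‖Σ_j f‖ = j! ‖z^j f‖ (`norm_toL2_sigmaOp`), while
‖zf‖² ≤ ‖f‖² ≤ 2‖zf‖² for holomorphic f smooth up to the boundary.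

Density: an element of A_j annihilates ∂̄^j(ρ^j q) for every q smooth up to the boundary, not only
for test functions (`pairL2_delbar_pow_rhoS_pow`). For q = z^b z̄^a this function is a nonzero
multiple of z^{b+j} z̄^a plus terms of lower degree in z, so an element of A_j is determined by its
integrals against z^b z̄^a with b < j (`eq_zero_of_mem_polyBergman`). For an element of A_(j+1),
orthogonality to A_j kills the moments with b < j, and orthogonality to the Σ_j z^a then kills those
with b = j. -/

lemma differentiableAt_smooth (f : Smooth) (z : ℂ) : DifferentiableAt ℝ (f : ℂ → ℂ) z :=
  (contDiff_smooth f).differentiable (by simp) z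

lemma smooth_ext {f g : Smooth} (h : ∀ z, (f : ℂ → ℂ) z = (g : ℂ → ℂ) z) : f = g :=
  Subtype.ext (funext h)

lemma dirDeriv_mul (v : ℂ) (f g : Smooth) :
    dirDeriv v (f * g) = dirDeriv v f * g + f * dirDeriv v g := by
  refine smooth_ext fun z => ?_
  change fderiv ℝ ((f : ℂ → ℂ) * (g : ℂ → ℂ)) z v =
    fderiv ℝ (f : ℂ → ℂ) z v * (g : ℂ → ℂ) z + (f : ℂ → ℂ) z * fderiv ℝ (g : ℂ → ℂ) z v
  rw [fderiv_mul (differentiableAt_smooth f z) (differentiableAt_smooth g z)]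
  simp only [add_apply, smul_apply, smul_eq_mul]
  ring

lemma dirDeriv_comm (v w : ℂ) (f : Smooth) :
    dirDeriv v (dirDeriv w f) = dirDeriv w (dirDeriv v f) := by
  refine smooth_ext fun z => ?_
  have h (a b : ℂ) : (dirDeriv a (dirDeriv b f) : ℂ → ℂ) z =
      fderiv ℝ (fderiv ℝ (f : ℂ → ℂ)) z a b := by
    have hd : DifferentiableAt ℝ (fderiv ℝ (f : ℂ → ℂ)) z :=
      ((contDiff_smooth f).fderiv_right (m := ∞) (by norm_num)).differentiable (by simp) z
    change fderiv ℝ (fun y => fderiv ℝ (f : ℂ → ℂ) y b) z a = _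
    rw [fderiv_clm_apply hd (differentiableAt_const b)]
    simp
  rw [h, h]
  exact ((contDiff_smooth f).contDiffAt.isSymmSndFDerivAt (by
    rw [minSmoothness_of_isRCLikeNormedField]; exact WithTop.coe_le_coe.2 le_top)).eq v w

lemma conjS_apply (f : Smooth) (z : ℂ) : (conjS f : ℂ → ℂ) z = star ((f : ℂ → ℂ) z) := rfl

lemma dirDeriv_conjS (v : ℂ) (f : Smooth) : dirDeriv v (conjS f) = conjS (dirDeriv v f) := by
  refine smooth_ext fun z => ?_
  change fderiv ℝ (fun z => star ((f : ℂ → ℂ) z)) z v = star (fderiv ℝ (f : ℂ → ℂ) z v)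
  rw [fderiv_star]
  rfl

lemma conjS_mul (f g : Smooth) : conjS (f * g) = conjS f * conjS g :=
  smooth_ext fun _ => star_mul' _ _

lemma conjS_add (f g : Smooth) : conjS (f + g) = conjS f + conjS g :=
  smooth_ext fun _ => star_add _ _

lemma conjS_sub (f g : Smooth) : conjS (f - g) = conjS f - conjS g :=
  smooth_ext fun _ => star_sub _ _

lemma conjS_neg (f : Smooth) : conjS (-f) = -conjS f :=
  smooth_ext fun _ => star_neg _

lemma conjS_one : conjS 1 = 1 := smooth_ext fun _ => star_one _

lemma conjS_smul (c : ℂ) (f : Smooth) : conjS (c • f) = star c • conjS f :=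
  smooth_ext fun _ => star_mul' _ _

lemma conjS_conjS (f : Smooth) : conjS (conjS f) = f := smooth_ext fun _ => star_star _

lemma conjS_pow (f : Smooth) (n : ℕ) : conjS (f ^ n) = conjS f ^ n := by
  induction n with
  | zero => simp [conjS_one]
  | succ n ih => rw [pow_succ, conjS_mul, ih, pow_succ]

lemma conjS_natCast (n : ℕ) : conjS (n : Smooth) = n := by
  induction n with
  | zero => exact smooth_ext fun _ => by simp [conjS_apply]
  | succ n ih => rw [Nat.cast_succ, conjS_add, ih, conjS_one]

lemma conjS_zero : conjS 0 = 0 := by simpa using conjS_natCast 0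

lemma del_apply (f : Smooth) :
    del f = (1 / 2 : ℂ) • (dirDeriv 1 f - Complex.I • dirDeriv Complex.I f) := rfl

lemma delbar_apply (f : Smooth) :
    delbar f = (1 / 2 : ℂ) • (dirDeriv 1 f + Complex.I • dirDeriv Complex.I f) := rfl

lemma del_mul (f g : Smooth) : del (f * g) = del f * g + f * del g := by
  simp only [del_apply, dirDeriv_mul, Algebra.smul_def]
  ring

lemma delbar_mul (f g : Smooth) : delbar (f * g) = delbar f * g + f * delbar g := by
  simp only [delbar_apply, dirDeriv_mul, Algebra.smul_def]
  ring

lemma conjS_del (f : Smooth) : conjS (del f) = delbar (conjS f) := by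
  simp only [del_apply, delbar_apply, conjS_smul, conjS_sub, dirDeriv_conjS, Complex.star_def,
    Complex.conj_I]
  congr 1
  · simp [map_ofNat]
  · module

lemma conjS_delbar (f : Smooth) : conjS (delbar f) = del (conjS f) := by
  rw [← conjS_conjS (del (conjS f)), conjS_del, conjS_conjS]

lemma conjS_del_pow (n : ℕ) (f : Smooth) : conjS ((del ^ n) f) = (delbar ^ n) (conjS f) := by
  induction n generalizing f with
  | zero => rfl
  | succ n ih => rw [pow_succ, pow_succ, Module.End.mul_apply, Module.End.mul_apply, ih, conjS_del]

lemma commute_del_delbar : Commute del delbar := by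
  refine LinearMap.ext fun f => ?_
  simp only [Module.End.mul_apply, del_apply, delbar_apply, map_smul, map_add, map_sub,
    dirDeriv_comm Complex.I 1]
  module

lemma delbar_del_pow (n : ℕ) (f : Smooth) : delbar ((del ^ n) f) = (del ^ n) (delbar f) := by
  rw [← Module.End.mul_apply, ← Module.End.mul_apply, (commute_del_delbar.pow_left n).eq]

lemma del_zS : del zS = 1 := by
  refine smooth_ext fun z => ?_
  change (1 / 2 : ℂ) * (fderiv ℝ (fun z : ℂ => z) z 1 -
    Complex.I * fderiv ℝ (fun z : ℂ => z) z Complex.I) = 1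
  rw [fderiv_fun_id]
  simp
  norm_num

lemma delbar_zS : delbar zS = 0 := by
  refine smooth_ext fun z => ?_
  change (1 / 2 : ℂ) * (fderiv ℝ (fun z : ℂ => z) z 1 +
    Complex.I * fderiv ℝ (fun z : ℂ => z) z Complex.I) = 0
  rw [fderiv_fun_id]
  simp

lemma del_conjS_zS : del (conjS zS) = 0 := by rw [← conjS_delbar, delbar_zS, conjS_zero]

lemma delbar_conjS_zS : delbar (conjS zS) = 1 := by rw [← conjS_del, del_zS, conjS_one]

lemma del_one : del 1 = 0 := by simpa using del_mul 1 1

lemma delbar_one : delbar 1 = 0 := by simpa using delbar_mul 1 1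

lemma del_rhoS : del rhoS = -conjS zS := by
  simp [rhoS, del_mul, del_zS, del_conjS_zS, del_one]

lemma delbar_rhoS : delbar rhoS = -zS := by
  simp [rhoS, delbar_mul, delbar_zS, delbar_conjS_zS, delbar_one]

lemma conjS_rhoS : conjS rhoS = rhoS := by
  simp [rhoS, conjS_sub, conjS_one, conjS_mul, conjS_conjS, mul_comm]

lemma delbar_pow_succ (f : Smooth) (n : ℕ) :
    delbar (f ^ (n + 1)) = ((n : Smooth) + 1) * f ^ n * delbar f := by
  induction n with
  | zero => simp
  | succ n ih => rw [pow_succ, delbar_mul, ih]; push_cast; ring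

lemma delbar_pow_of_delbar_eq_zero {f : Smooth} (hf : delbar f = 0) (n : ℕ) :
    delbar (f ^ n) = 0 := by
  cases n with
  | zero => simp [delbar_one]
  | succ n => rw [delbar_pow_succ, hf, mul_zero]

lemma del_natCast_mul (n : ℕ) (f : Smooth) : del ((n : Smooth) * f) = n * del f := by
  rw [← nsmul_eq_mul, map_nsmul, nsmul_eq_mul]

lemma del_pow_natCast_mul (m n : ℕ) (f : Smooth) :
    (del ^ m) ((n : Smooth) * f) = n * (del ^ m) f := by
  rw [← nsmul_eq_mul, map_nsmul, nsmul_eq_mul]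

/-- Leibniz rule for `∂ⁿ⁺¹ (a h)` when `∂² a = 0`. -/
lemma del_pow_mul_of_del_del {a : Smooth} (ha : del (del a) = 0) (n : ℕ) (h : Smooth) :
    (del ^ (n + 1)) (a * h) =
      a * (del ^ (n + 1)) h + ((n : Smooth) + 1) * (del a * (del ^ n) h) := by
  induction n with
  | zero => simp [del_mul]; ring
  | succ n ih =>
    have hp (m : ℕ) (k : Smooth) : (del ^ (m + 1)) k = del ((del ^ m) k) := by
      rw [pow_succ', Module.End.mul_apply]
    rw [hp (n + 1), ih, map_add, del_mul, ← Nat.cast_succ, del_natCast_mul, del_mul, ha,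
      hp (n + 1) h, hp n h]
    push_cast
    ring

/-! ### Ladder relations for Σ_j and the three-term recurrence -/

lemma sigmaOp_apply (j : ℕ) (f : Smooth) : sigmaOp j f = (del ^ j) (rhoS ^ j * f) := rfl

/-- Split off one factor ρ in ∂^{j+1}(ρ · ρ^j f). Since ρ is affine in z for fixed z̄, the Leibniz
rule has only two terms. Holomorphy of f plays no role. -/
lemma rho_mul_del_sigmaOp (j : ℕ) (f : Smooth) :
    rhoS * del (sigmaOp j f) = sigmaOp (j + 1) f + ((j : Smooth) + 1) * (conjS zS * sigmaOp j f) := by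
  have h : sigmaOp (j + 1) f = rhoS * (del ^ (j + 1)) (rhoS ^ j * f) +
      ((j : Smooth) + 1) * (del rhoS * (del ^ j) (rhoS ^ j * f)) := by
    rw [← del_pow_mul_of_del_del (by rw [del_rhoS, map_neg, del_conjS_zS, neg_zero]), sigmaOp_apply,
      pow_succ' rhoS, mul_assoc]
  rw [h, del_rhoS, sigmaOp_apply, pow_succ', Module.End.mul_apply]
  ring

/-- ∂̄ commutes with ∂^{j+1} and meets only ρ^{j+1}, producing -(j+1) z ρ^j f; Leibniz with the
affine factor z finishes. -/
lemma delbar_sigmaOp_succ (j : ℕ) {f : Smooth} (hf : delbar f = 0) :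
    delbar (sigmaOp (j + 1) f) = -((j : Smooth) + 1) *
      (zS * del (sigmaOp j f) + ((j : Smooth) + 1) * sigmaOp j f) := by
  have h1 : delbar (rhoS ^ (j + 1) * f) = -(((j + 1 : ℕ) : Smooth) * (zS * (rhoS ^ j * f))) := by
    rw [delbar_mul, hf, delbar_pow_succ, delbar_rhoS]
    push_cast
    ring
  rw [sigmaOp_apply, delbar_del_pow, h1, map_neg, del_pow_natCast_mul,
    del_pow_mul_of_del_del (by rw [del_zS, del_one]), del_zS, sigmaOp_apply, pow_succ',
    Module.End.mul_apply]
  push_cast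
  ring

lemma rho_mul_delbar_sigmaOp (j : ℕ) {f : Smooth} (hf : delbar f = 0) :
    rhoS * delbar (sigmaOp j f) =
      -(j : Smooth) * (zS * sigmaOp j f) - (j : Smooth) ^ 2 * sigmaOp (j - 1) f := by
  cases j with
  | zero => simp [sigmaOp_apply, hf]
  | succ j =>
    have h := rho_mul_del_sigmaOp j f
    have hr : rhoS = 1 - zS * conjS zS := rfl
    rw [delbar_sigmaOp_succ j hf, Nat.add_sub_cancel]
    -- After the raising relation is inserted, the coefficient of Σ_j f contains z z̄ + ρ, which
    -- equals 1.
    calc _ = -((j : Smooth) + 1) * (zS * (rhoS * del (sigmaOp j f)) +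
          ((j : Smooth) + 1) * (rhoS * sigmaOp j f)) := by ring
      _ = _ := by rw [h, hr]; push_cast; ring

/-- The operator `u ↦ ρ ∂ ∂̄ (ρ u)`, the formal adjoint of `Δ ρ² / 4 + ∂ z ρ + z̄ ∂̄ ρ`. -/
def adjY (h : Smooth) : Smooth := rhoS * del (delbar (rhoS * h))

lemma adjY_eq (h : Smooth) : adjY h =
    rhoS * rhoS * del (delbar h) - zS * rhoS * del h - rhoS * delbar (conjS zS * h) := by
  simp only [adjY, delbar_mul, del_mul, map_add, delbar_rhoS, delbar_conjS_zS, del_rhoS, map_neg,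
    del_zS]
  have hr : rhoS = 1 - zS * conjS zS := rfl
  ring

/-- The heart of the algebra: ∂̄ and then ρ∂ each turn a product of neighbouring Σ's into other such
products with constant coefficients. At j = 0 the truncated index j - 1 is harmless because its
coefficient is 0. -/
lemma adjY_sigmaOp (j : ℕ) {f g : Smooth} (hf : delbar f = 0) (hg : delbar g = 0) :
    adjY (sigmaOp j f * conjS (sigmaOp j g)) =
      sigmaOp (j + 1) f * conjS (sigmaOp (j + 1) g)
      - (((j : Smooth) + 1) ^ 2 + (j : Smooth) ^ 2) * (sigmaOp j f * conjS (sigmaOp j g))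
      + (j : Smooth) ^ 4 * (sigmaOp (j - 1) f * conjS (sigmaOp (j - 1) g)) := by
  have hu (n : ℕ) := rho_mul_del_sigmaOp n f
  have hub (n : ℕ) := rho_mul_delbar_sigmaOp n hf
  have hvb (n : ℕ) : rhoS * delbar (conjS (sigmaOp n g)) =
      conjS (sigmaOp (n + 1) g) + ((n : Smooth) + 1) * (zS * conjS (sigmaOp n g)) := by
    simpa [conjS_mul, conjS_add, conjS_del, conjS_rhoS, conjS_natCast, conjS_one, conjS_conjS]
      using congrArg conjS (rho_mul_del_sigmaOp n g)
  have hv (n : ℕ) : rhoS * del (conjS (sigmaOp n g)) =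
      -(n : Smooth) * (conjS zS * conjS (sigmaOp n g))
        - (n : Smooth) ^ 2 * conjS (sigmaOp (n - 1) g) := by
    have := congrArg conjS (rho_mul_delbar_sigmaOp n hg)
    simp only [conjS_mul, conjS_delbar, conjS_rhoS, conjS_sub, conjS_pow, conjS_natCast,
      conjS_neg] at this
    exact this
  -- The z-terms come with coefficients -1 from ∂̄ρ, -j from lowering and j + 1 from raising, and
  -- cancel.
  have h1 : delbar (rhoS * (sigmaOp j f * conjS (sigmaOp j g))) =
      sigmaOp j f * conjS (sigmaOp (j + 1) g)
        - ((j ^ 2 : ℕ) : Smooth) * (sigmaOp (j - 1) f * conjS (sigmaOp j g)) := by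
    rw [delbar_mul, delbar_mul, delbar_rhoS]
    linear_combination (norm := skip) sigmaOp j f * hvb j + conjS (sigmaOp j g) * hub j
    push_cast
    ring
  rw [adjY, h1, map_sub, del_natCast_mul, del_mul, del_mul]
  -- For j > 0 the product of Σ_{j-1} f with conj(Σ_j g) also has to be differentiated, which uses
  -- the ladder relations one level lower.
  cases j with
  | zero =>
    have e1 := hu 0
    have e2 := hv 1
    linear_combination (norm := skip) conjS (sigmaOp 1 g) * e1 + sigmaOp 0 f * e2
    push_cast
    ring
  | succ j =>
    have e1 := hu (j + 1)
    have e2 := hv (j + 1 + 1)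
    have e3 := hu j
    have e4 := hv (j + 1)
    rw [Nat.add_sub_cancel] at e2 e4 ⊢
    linear_combination (norm := skip) conjS (sigmaOp (j + 1 + 1) g) * e1 + sigmaOp (j + 1) f * e2
      - ((j : Smooth) + 1) ^ 2 * (conjS (sigmaOp (j + 1) g) * e3 + sigmaOp j f * e4)
    push_cast
    ring

lemma delbar_basisSpan {f : Smooth} (hf : f ∈ basisSpan) : delbar f = 0 := by
  have h : basisSpan ≤ LinearMap.ker delbar := by
    refine Submodule.span_le.2 ?_
    rintro _ ⟨k, rfl⟩
    simp only [SetLike.mem_coe, LinearMap.mem_ker, basisFn, map_smul,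
      delbar_pow_of_delbar_eq_zero delbar_zS, smul_zero]
  exact h hf

/-! ### Operators on distributions -/

lemma diskDist_ext {F G : DiskDist} (h : ∀ φ, pair F φ = pair G φ) : F = G :=
  Subtype.ext (LinearMap.ext h)

lemma pair_add (F G : DiskDist) (φ : Smooth) : pair (F + G) φ = pair F φ + pair G φ := rfl

lemma pair_sub (F G : DiskDist) (φ : Smooth) : pair (F - G) φ = pair F φ - pair G φ := rfl

lemma pair_smul (c : ℂ) (F : DiskDist) (φ : Smooth) : pair (c • F) φ = c * pair F φ := rfl

lemma pair_distMul (a : Smooth) (F : DiskDist) (φ : Smooth) :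
    pair (distMul a F) φ = pair F (a * φ) := rfl

lemma pair_distDeriv (v : ℂ) (F : DiskDist) (φ : Smooth) :
    pair (distDeriv v F) φ = -pair F (dirDeriv v φ) := rfl

lemma pair_right_smul (F : DiskDist) (c : ℂ) (φ : Smooth) : pair F (c • φ) = c * pair F φ :=
  map_smul (F : Module.Dual ℂ Smooth) c φ

lemma pair_right_add (F : DiskDist) (φ ψ : Smooth) : pair F (φ + ψ) = pair F φ + pair F ψ :=
  map_add (F : Module.Dual ℂ Smooth) φ ψ

lemma pair_right_sub (F : DiskDist) (φ ψ : Smooth) : pair F (φ - ψ) = pair F φ - pair F ψ :=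
  map_sub (F : Module.Dual ℂ Smooth) φ ψ

lemma pair_right_natCast_mul (F : DiskDist) (n : ℕ) (φ : Smooth) :
    pair F ((n : Smooth) * φ) = n * pair F φ := by
  have := map_nsmul (F : Module.Dual ℂ Smooth) n φ
  rwa [nsmul_eq_mul, nsmul_eq_mul] at this

lemma pair_distDel (F : DiskDist) (φ : Smooth) : pair (distDel F) φ = -pair F (del φ) := by
  simp only [distDel, LinearMap.smul_apply, LinearMap.sub_apply, pair_smul, pair_sub,
    pair_distDeriv, del_apply, pair_right_smul, pair_right_sub]
  ring

lemma pair_distDelbar (F : DiskDist) (φ : Smooth) :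
    pair (distDelbar F) φ = -pair F (delbar φ) := by
  simp only [distDelbar, LinearMap.smul_apply, LinearMap.add_apply, pair_smul, pair_add,
    pair_distDeriv, delbar_apply, pair_right_smul, pair_right_add]
  ring

lemma commute_distDel_distDelbar : Commute distDel distDelbar := by
  refine LinearMap.ext fun F => diskDist_ext fun φ => ?_
  have := LinearMap.congr_fun commute_del_delbar.eq φ
  simp only [Module.End.mul_apply] at this
  simp only [Module.End.mul_apply, pair_distDel, pair_distDelbar, this]

lemma distLap_eq : distLap = (4 : ℂ) • (distDelbar * distDel) := by
  refine LinearMap.ext fun F => diskDist_ext fun φ => ?_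
  simp only [distLap, pow_two, LinearMap.add_apply, LinearMap.smul_apply, Module.End.mul_apply,
    pair_add, pair_smul, pair_distDeriv, pair_distDel, pair_distDelbar, del_apply, delbar_apply,
    pair_right_smul, pair_right_add, pair_right_sub,
    dirDeriv_comm Complex.I 1]
  linear_combination (pair F (dirDeriv Complex.I (dirDeriv Complex.I φ))) * Complex.I_mul_I

lemma distMul_mul (a b : Smooth) : distMul (a * b) = distMul a * distMul b :=
  LinearMap.ext fun F => diskDist_ext fun φ => by
    simp only [Module.End.mul_apply, pair_distMul]
    congr 1
    ring

lemma distMul_add (a b : Smooth) : distMul (a + b) = distMul a + distMul b :=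
  LinearMap.ext fun F => diskDist_ext fun φ => by
    simp only [LinearMap.add_apply, pair_add, pair_distMul, add_mul, pair_right_add]

lemma distMul_smul (c : ℂ) (a : Smooth) : distMul (c • a) = c • distMul a :=
  LinearMap.ext fun F => diskDist_ext fun φ => by
    simp only [LinearMap.smul_apply, pair_smul, pair_distMul, smul_mul_assoc, pair_right_smul]

lemma distMul_zero : distMul 0 = 0 := by simpa using distMul_smul 0 0

lemma distMul_one : distMul 1 = 1 :=
  LinearMap.ext fun F => diskDist_ext fun φ => by
    rw [pair_distMul, one_mul, Module.End.one_apply]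

lemma distDel_mul_distMul (a : Smooth) :
    distDel * distMul a = distMul a * distDel + distMul (del a) :=
  LinearMap.ext fun F => diskDist_ext fun φ => by
    simp only [Module.End.mul_apply, LinearMap.add_apply, pair_add, pair_distDel, pair_distMul,
      del_mul, pair_right_add]
    ring

lemma distDelbar_mul_distMul (a : Smooth) :
    distDelbar * distMul a = distMul a * distDelbar + distMul (delbar a) :=
  LinearMap.ext fun F => diskDist_ext fun φ => by
    simp only [Module.End.mul_apply, LinearMap.add_apply, pair_add, pair_distDelbar, pair_distMul,
      delbar_mul, pair_right_add]
    ring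

/-- The operator `Δ ρ² / 4 + ∂ z ρ + z̄ ∂̄ ρ` on distributions. -/
def opY : Module.End ℂ DiskDist :=
  (1 / 4 : ℂ) • monomialOp [Gen.lapl] + monomialOp [Gen.dz] + monomialOp [Gen.zd]

lemma opY_eq : opY = distDelbar * (distDel * distMul (rhoS * rhoS)) +
    distDel * distMul (zS * rhoS) + distMul (conjS zS) * (distDelbar * distMul rhoS) := by
  simp [opY, monomialOp, expand, Gen.word, Letter.op, distLap_eq, distMul_mul, mul_assoc, smul_smul]

lemma pair_opY (F : DiskDist) (φ : Smooth) : pair (opY F) φ = pair F (adjY φ) := by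
  simp only [opY_eq, LinearMap.add_apply, Module.End.mul_apply, pair_add, pair_distDelbar,
    pair_distDel, pair_distMul, adjY_eq, pair_right_sub, neg_neg, mul_assoc]
  have := LinearMap.congr_fun commute_del_delbar.eq φ
  simp only [Module.End.mul_apply] at this
  rw [this]
  ring

/-! ### The polynomials -/

/-- Multiplication of a polynomial on the right by the variable `g`. -/
def mulGen (g : Gen) (P : NCPoly) : NCPoly := P.mapDomain (· ++ [g])

lemma mulGen_append (g : Gen) (P : NCPoly) (w : List Gen) : mulGen g P (w ++ [g]) = P w :=
  Finsupp.mapDomain_apply (List.append_left_injective [g]) P w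

lemma mulGen_append_of_ne {g g' : Gen} (h : g' ≠ g) (P : NCPoly) (w : List Gen) :
    mulGen g P (w ++ [g']) = 0 := by
  refine Finsupp.mapDomain_of_notMem_range _ _ ?_
  rintro ⟨v, hv⟩
  have := List.append_inj_right' hv rfl
  simp at this
  exact h this.symm

lemma mulGen_nil (g : Gen) (P : NCPoly) : mulGen g P [] = 0 :=
  Finsupp.mapDomain_of_notMem_range _ _ (by simp)

lemma mulGen_eq_zero_of_length {n : ℕ} {P : NCPoly} (hP : ∀ w : List Gen, n < w.length → P w = 0)
    (g : Gen) (w : List Gen) (hw : n + 1 < w.length) : mulGen g P w = 0 := by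
  rcases List.eq_nil_or_concat' w with rfl | ⟨v, g', rfl⟩
  · exact mulGen_nil g P
  · by_cases h : g' = g
    · subst h
      rw [mulGen_append]
      exact hP v (by simpa using hw)
    · exact mulGen_append_of_ne h P v

lemma evalOp_eq (P : NCPoly) : evalOp P = Finsupp.linearCombination ℂ monomialOp P := rfl

lemma monomialOp_append (v w : List Gen) : monomialOp (v ++ w) = monomialOp v * monomialOp w := by
  simp [monomialOp, expand]

/-- Appending a letter on the right of every monomial is composition on the right: the new factor
acts first. -/
lemma evalOp_mulGen (g : Gen) (P : NCPoly) :
    evalOp (mulGen g P) = evalOp P * monomialOp [g] := by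
  rw [evalOp_eq, evalOp_eq, mulGen, Finsupp.linearCombination_mapDomain]
  induction P using Finsupp.induction_linear with
  | zero => simp
  | add P Q hP hQ => rw [map_add, map_add, hP, hQ, add_mul]
  | single w c => simp [monomialOp_append]

/-- Multiplication of a polynomial on the right by `Δ ρ² / 4 + ∂ z ρ + z̄ ∂̄ ρ`. -/
def mulY (P : NCPoly) : NCPoly :=
  (1 / 4 : ℂ) • mulGen .lapl P + mulGen .dz P + mulGen .zd P

lemma evalOp_mulY (P : NCPoly) : evalOp (mulY P) = evalOp P * opY := by
  rw [mulY, evalOp_eq, map_add, map_add, map_smul, ← evalOp_eq, ← evalOp_eq, ← evalOp_eq,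
    evalOp_mulGen, evalOp_mulGen, evalOp_mulGen, opY, mul_add, mul_add, mul_smul_comm]

/-- The monic continuous dual Hahn polynomials in `Δ ρ² / 4 + ∂ z ρ + z̄ ∂̄ ρ`, given by their
three-term recurrence. -/
def symbolPoly : ℕ → NCPoly
  | 0 => Finsupp.single [] 1
  | n + 1 => mulY (symbolPoly n) + (((n + 1) ^ 2 + n ^ 2 : ℕ) : ℂ) • symbolPoly n
      + (-((n ^ 4 : ℕ) : ℂ)) • symbolPoly (n - 1)
termination_by n => n
decreasing_by all_goals omega

lemma symbolPoly_succ (n : ℕ) : symbolPoly (n + 1) =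
    mulY (symbolPoly n) + (((n + 1) ^ 2 + n ^ 2 : ℕ) : ℂ) • symbolPoly n
      + (-((n ^ 4 : ℕ) : ℂ)) • symbolPoly (n - 1) := by
  rw [symbolPoly]

lemma evalOp_symbolPoly_zero : evalOp (symbolPoly 0) = 1 := by
  rw [symbolPoly, evalOp_eq, Finsupp.linearCombination_single, one_smul]
  rfl

lemma evalOp_symbolPoly_succ (n : ℕ) : evalOp (symbolPoly (n + 1)) =
    evalOp (symbolPoly n) * opY + (((n + 1) ^ 2 + n ^ 2 : ℕ) : ℂ) • evalOp (symbolPoly n)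
      + (-((n ^ 4 : ℕ) : ℂ)) • evalOp (symbolPoly (n - 1)) := by
  rw [symbolPoly_succ, evalOp_eq, map_add, map_add, map_smul, map_smul, ← evalOp_eq, ← evalOp_eq,
    ← evalOp_eq, evalOp_mulY]

lemma symbolPoly_eq_zero_of_length (n : ℕ) :
    ∀ w : List Gen, n < w.length → symbolPoly n w = 0 := by
  induction n using Nat.strong_induction_on with
  | _ n ih =>
    intro w hw
    cases n with
    | zero =>
      rw [symbolPoly, Finsupp.single_eq_of_ne]
      rintro rfl
      simp at hw
    | succ n =>
      have h1 := mulGen_eq_zero_of_length (ih n (by omega))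
      have h2 := ih n (by omega) w (by omega)
      have h3 := ih (n - 1) (by omega) w (by omega)
      simp [symbolPoly_succ, mulY, h1 _ w hw, h2, h3]

/-- This monomial shows that the degree is exactly n: it arises only by choosing Δρ²/4 at each of
the n multiplications by Y. -/
lemma symbolPoly_replicate (n : ℕ) :
    symbolPoly n (List.replicate n Gen.lapl) = (1 / 4 : ℂ) ^ n := by
  induction n with
  | zero => simp [symbolPoly]
  | succ n ih =>
    have h2 := symbolPoly_eq_zero_of_length n (List.replicate (n + 1) Gen.lapl) (by simp)
    have h3 := symbolPoly_eq_zero_of_length (n - 1) (List.replicate (n + 1) Gen.lapl)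
      (by simp)
    simp only [symbolPoly_succ, mulY, Finsupp.add_apply, Finsupp.smul_apply, h2,
      h3]
    rw [List.replicate_succ', mulGen_append, mulGen_append_of_ne (by simp),
      mulGen_append_of_ne (by simp), ih]
    simp only [smul_eq_mul, mul_zero, add_zero]
    ring

lemma hasDegree_symbolPoly (n : ℕ) : HasDegree (symbolPoly n) n := by
  refine ⟨fun w hw => ?_, List.replicate n Gen.lapl, ?_, by simp⟩
  · by_contra! h
    exact Finsupp.mem_support_iff.1 hw (symbolPoly_eq_zero_of_length n w h)
  · rw [Finsupp.mem_support_iff, symbolPoly_replicate]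
    exact pow_ne_zero _ (by norm_num)

/-- Each of the three variables has weight zero on its own, so no property of the particular
polynomial is needed. -/
lemma weight_eq_zero (w : List Gen) : weight w = 0 := by
  induction w with
  | nil => rfl
  | cons g w ih =>
    have h : weight (g :: w) = weight [g] + weight w := by simp [weight, expand]
    rw [h, ih]
    cases g <;> rfl

/-! ### The identity between the two forms -/

/-- Pair F with the recurrence for the products and move ρ∂∂̄ρ over to F as Y. The induction
hypothesis is then applied to the distribution YF as well as to F, so F is quantified inside the
induction. -/
lemma pair_sigmaOp_mul_conjS (j : ℕ) {f g : Smooth} (hf : delbar f = 0) (hg : delbar g = 0) :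
    ∀ F : DiskDist, pair F (sigmaOp j f * conjS (sigmaOp j g)) =
      pair (evalOp (symbolPoly j) F) (f * conjS g) := by
  induction j using Nat.strong_induction_on with
  | _ j ih =>
    intro F
    cases j with
    | zero => simp [evalOp_symbolPoly_zero, sigmaOp_apply]
    | succ j =>
      have h := congrArg (pair F) (adjY_sigmaOp j hf hg)
      rw [← pair_opY, ih j (by omega), pair_right_add, pair_right_sub] at h
      have c1 : ((j : Smooth) + 1) ^ 2 + (j : Smooth) ^ 2 = (((j + 1) ^ 2 + j ^ 2 : ℕ) : Smooth) := by
        push_cast; rfl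
      have c2 : (j : Smooth) ^ 4 = ((j ^ 4 : ℕ) : Smooth) := by push_cast; rfl
      rw [c1, c2, pair_right_natCast_mul, pair_right_natCast_mul, ih j (by omega),
        ih (j - 1) (by omega)] at h
      rw [evalOp_symbolPoly_succ]
      simp only [LinearMap.add_apply, LinearMap.smul_apply, pair_add,
        pair_smul, Module.End.mul_apply]
      linear_combination -h

/-! ### Ellipticity -/

/-- The differential operators of order less than `m` with smooth coefficients. -/
def diffOpLT (m : ℕ) : Submodule ℂ (Module.End ℂ DiskDist) :=
  Submodule.span ℂ {L | ∃ a k l, k + l < m ∧ L = distMul a * distDel ^ k * distDelbar ^ l}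

lemma mem_diffOpLT (a : Smooth) {k l m : ℕ} (h : k + l < m) :
    distMul a * distDel ^ k * distDelbar ^ l ∈ diffOpLT m :=
  Submodule.subset_span ⟨a, k, l, h, rfl⟩

lemma diffOpLT_mono {m n : ℕ} (h : m ≤ n) : diffOpLT m ≤ diffOpLT n := by
  refine Submodule.span_mono ?_
  rintro _ ⟨a, k, l, hkl, rfl⟩
  exact ⟨a, k, l, by omega, rfl⟩

lemma mul_mem_diffOpLT {A : Module.End ℂ DiskDist} {m n : ℕ}
    (hA : ∀ a k l, k + l < m → A * (distMul a * distDel ^ k * distDelbar ^ l) ∈ diffOpLT n)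
    {L : Module.End ℂ DiskDist} (hL : L ∈ diffOpLT m) : A * L ∈ diffOpLT n := by
  have : diffOpLT m ≤ (diffOpLT n).comap (LinearMap.mulLeft ℂ A) := by
    refine Submodule.span_le.2 ?_
    rintro _ ⟨a, k, l, hkl, rfl⟩
    exact hA a k l hkl
  exact this hL

lemma distMul_mul_mem {m : ℕ} (b : Smooth) {L : Module.End ℂ DiskDist} (hL : L ∈ diffOpLT m) :
    distMul b * L ∈ diffOpLT m :=
  mul_mem_diffOpLT (fun a k l h => by
    rw [← mul_assoc, ← mul_assoc, ← distMul_mul]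
    exact mem_diffOpLT _ h) hL

lemma distDel_mul_monomial (a : Smooth) (k l : ℕ) :
    distDel * (distMul a * distDel ^ k * distDelbar ^ l) =
      distMul a * distDel ^ (k + 1) * distDelbar ^ l +
        distMul (del a) * distDel ^ k * distDelbar ^ l := by
  rw [← mul_assoc, ← mul_assoc, distDel_mul_distMul, add_mul, add_mul, mul_assoc (distMul a),
    pow_succ']

lemma distDelbar_mul_monomial (a : Smooth) (k l : ℕ) :
    distDelbar * (distMul a * distDel ^ k * distDelbar ^ l) =
      distMul a * distDel ^ k * distDelbar ^ (l + 1) +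
        distMul (delbar a) * distDel ^ k * distDelbar ^ l := by
  rw [← mul_assoc, ← mul_assoc, distDelbar_mul_distMul, add_mul, add_mul, mul_assoc (distMul a),
    ← (commute_distDel_distDelbar.pow_left k).eq, pow_succ' _ l, mul_assoc, mul_assoc, mul_assoc,
    mul_assoc]

lemma distDel_mul_mem {m : ℕ} {L : Module.End ℂ DiskDist} (hL : L ∈ diffOpLT m) :
    distDel * L ∈ diffOpLT (m + 1) :=
  mul_mem_diffOpLT (fun a k l h => by
    rw [distDel_mul_monomial]
    exact add_mem (mem_diffOpLT _ (by omega)) (mem_diffOpLT _ (by omega))) hL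

lemma distDelbar_mul_mem {m : ℕ} {L : Module.End ℂ DiskDist} (hL : L ∈ diffOpLT m) :
    distDelbar * L ∈ diffOpLT (m + 1) :=
  mul_mem_diffOpLT (fun a k l h => by
    rw [distDelbar_mul_monomial]
    exact add_mem (mem_diffOpLT _ (by omega)) (mem_diffOpLT _ (by omega))) hL

lemma opY_mul_mem {m : ℕ} {L : Module.End ℂ DiskDist} (hL : L ∈ diffOpLT m) :
    opY * L ∈ diffOpLT (m + 2) := by
  simp only [opY_eq, add_mul, mul_assoc]
  refine add_mem (add_mem ?_ ?_) ?_
  · exact distDelbar_mul_mem (distDel_mul_mem (distMul_mul_mem _ hL))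
  · exact diffOpLT_mono (by omega) (distDel_mul_mem (distMul_mul_mem _ hL))
  · exact diffOpLT_mono (by omega)
      (distMul_mul_mem _ (distDelbar_mul_mem (distMul_mul_mem _ hL)))

/-- Only Δρ²/4 = ∂̄∂ρ² contributes in top order; every commutator with a coefficient, and the two
first-order terms of Y, fall into the remainder. -/
lemma opY_mul_monomial (a : Smooth) (k l : ℕ) :
    ∃ R ∈ diffOpLT (k + l + 2), opY * (distMul a * distDel ^ k * distDelbar ^ l) =
      distMul (rhoS * rhoS * a) * distDel ^ (k + 1) * distDelbar ^ (l + 1) + R := by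
  have h0 (b : Smooth) := mem_diffOpLT (m := k + l + 1) (b * a) (k := k) (l := l) (by omega)
  have h1 (b : Smooth) : distMul b * (distMul a * distDel ^ k * distDelbar ^ l) =
      distMul (b * a) * distDel ^ k * distDelbar ^ l := by
    rw [distMul_mul, mul_assoc, mul_assoc, mul_assoc]
  simp only [opY_eq, add_mul, mul_assoc distDelbar, mul_assoc distDel,
    mul_assoc (distMul (conjS zS)), h1]
  rw [distDel_mul_monomial (rhoS * rhoS * a), mul_add, distDelbar_mul_monomial,
    add_assoc (distMul _ * _ * _), add_assoc (distMul _ * _ * _), add_assoc (distMul _ * _ * _)]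
  refine ⟨_, ?_, rfl⟩
  refine add_mem (add_mem ?_ ?_) ?_
  · exact add_mem (mem_diffOpLT _ (by omega)) (distDelbar_mul_mem (mem_diffOpLT _ (by omega)))
  · exact distDel_mul_mem (h0 _)
  · exact distMul_mul_mem _ (distDelbar_mul_mem (h0 _))

/-- All these operators are polynomials in Y. This allows M_n Y to be rewritten as Y M_n, so that
orders need tracking only under multiplication from the left. -/
lemma commute_evalOp_symbolPoly (n : ℕ) : Commute (evalOp (symbolPoly n)) opY := by
  induction n using Nat.strong_induction_on with
  | _ n ih =>
    cases n with
    | zero => rw [evalOp_symbolPoly_zero]; exact Commute.one_left _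
    | succ n =>
      have h1 := ih n (by omega)
      have h2 := ih (n - 1) (by omega)
      rw [evalOp_symbolPoly_succ]
      exact ((h1.mul_left (Commute.refl _)).add_left (h1.smul_left _)).add_left (h2.smul_left _)

lemma exists_evalOp_symbolPoly_eq (n : ℕ) :
    ∃ R ∈ diffOpLT (2 * n), evalOp (symbolPoly n) =
      distMul (rhoS ^ (2 * n)) * distDel ^ n * distDelbar ^ n + R := by
  induction n using Nat.strong_induction_on with
  | _ n ih =>
    have hlow (i : ℕ) (hi : i < n) : evalOp (symbolPoly i) ∈ diffOpLT (2 * i + 1) := by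
      obtain ⟨R, hR, h⟩ := ih i hi
      rw [h]
      exact add_mem (mem_diffOpLT _ (by omega)) (diffOpLT_mono (by omega) hR)
    cases n with
    | zero => exact ⟨0, zero_mem _, by simp [evalOp_symbolPoly_zero, distMul_one]⟩
    | succ n =>
      obtain ⟨R, hR, h1⟩ := ih n (by omega)
      obtain ⟨R', hR', h2⟩ := opY_mul_monomial (rhoS ^ (2 * n)) n n
      have h3 : rhoS * rhoS * rhoS ^ (2 * n) = rhoS ^ (2 * (n + 1)) := by ring
      have h4 : evalOp (symbolPoly n) * opY =
          distMul (rhoS ^ (2 * (n + 1))) * distDel ^ (n + 1) * distDelbar ^ (n + 1) +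
            (R' + opY * R) := by
        rw [(commute_evalOp_symbolPoly n).eq, h1, mul_add opY, h2, h3, add_assoc]
      rw [evalOp_symbolPoly_succ, h4, add_assoc, add_assoc]
      refine ⟨_, ?_, rfl⟩
      exact add_mem (add_mem (diffOpLT_mono (by omega) hR') (opY_mul_mem hR)) (add_mem
        (Submodule.smul_mem _ _ (diffOpLT_mono (by omega) (hlow n (by omega))))
        (Submodule.smul_mem _ _ (diffOpLT_mono (by omega) (hlow (n - 1) (by omega)))))

lemma sum_monomial_single (M : ℕ) (b : Smooth) {k l : ℕ} (h : k + l ≤ M) :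
    ∑ k' ∈ Finset.range (M + 1), ∑ l' ∈ Finset.range (M + 1 - k'),
      distMul (if k' = k ∧ l' = l then b else 0) * distDel ^ k' * distDelbar ^ l' =
        distMul b * distDel ^ k * distDelbar ^ l := by
  rw [Finset.sum_eq_single k, Finset.sum_eq_single l]
  · simp
  · intro l' _ hl
    simp [hl, distMul_zero]
  · intro hl
    exact absurd (Finset.mem_range.2 (by omega)) hl
  · intro k' _ hk
    simp [hk, distMul_zero]
  · intro hk
    exact absurd (Finset.mem_range.2 (by omega)) hk

/-- The vanishing of the coefficients with k + l ≥ m is what keeps the remainder out of the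
principal symbol. -/
lemma exists_coeff_of_mem_diffOpLT {m M : ℕ} (hm : m ≤ M + 1) {L : Module.End ℂ DiskDist}
    (hL : L ∈ diffOpLT m) :
    ∃ a : ℕ → ℕ → Smooth, (∀ k l, m ≤ k + l → a k l = 0) ∧
      L = ∑ k ∈ Finset.range (M + 1), ∑ l ∈ Finset.range (M + 1 - k),
        distMul (a k l) * distDel ^ k * distDelbar ^ l := by
  induction hL using Submodule.span_induction with
  | mem L h =>
    obtain ⟨b, k, l, hkl, rfl⟩ := h
    refine ⟨fun k' l' => if k' = k ∧ l' = l then b else 0, fun k' l' h' => ?_,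
      (sum_monomial_single M b (by omega)).symm⟩
    exact if_neg (by omega)
  | zero => exact ⟨0, fun _ _ _ => rfl, by simp [distMul_zero]⟩
  | add L L' _ _ h h' =>
    obtain ⟨a, ha, rfl⟩ := h
    obtain ⟨b, hb, rfl⟩ := h'
    refine ⟨a + b, fun k l hkl => by simp [ha k l hkl, hb k l hkl], ?_⟩
    simp [distMul_add, add_mul, Finset.sum_add_distrib]
  | smul c L _ h =>
    obtain ⟨a, ha, rfl⟩ := h
    refine ⟨c • a, fun k l hkl => by simp [ha k l hkl], ?_⟩
    simp [distMul_smul, Finset.smul_sum]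

lemma rhoS_ne_zero {z : ℂ} (hz : z ∈ Metric.ball (0 : ℂ) 1) : (rhoS : ℂ → ℂ) z ≠ 0 := by
  rw [rhoS_apply, sub_ne_zero]
  have h : ‖z‖ < 1 := by simpa using hz
  intro h1
  have h2 : (1 : ℝ) = ‖z‖ ^ 2 := by exact_mod_cast h1
  nlinarith [norm_nonneg z]

lemma isEllipticOfOrder_symbolPoly (n : ℕ) :
    IsEllipticOfOrder (2 * n) (evalOp (symbolPoly n)) := by
  obtain ⟨R, hR, hL⟩ := exists_evalOp_symbolPoly_eq n
  obtain ⟨a, ha, rfl⟩ := exists_coeff_of_mem_diffOpLT (M := 2 * n) (by omega) hR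
  refine ⟨fun k l => a k l + if k = n ∧ l = n then rhoS ^ (2 * n) else 0, ?_, fun z hz ξ hξ => ?_⟩
  · simp only [distMul_add, add_mul, Finset.sum_add_distrib]
    rw [sum_monomial_single _ _ (by omega), hL, add_comm]
  -- The principal symbol has the single term k = n, namely ρ^{2n} (i ξ̄/2)^n (i ξ/2)^n.
  · rw [Finset.sum_eq_single n]
    · beta_reduce
      rw [ha n (2 * n - n) (by omega), if_pos ⟨rfl, by omega⟩, zero_add]
      refine mul_ne_zero (mul_ne_zero ?_ (pow_ne_zero _ ?_)) (pow_ne_zero _ ?_)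
      · change ((rhoS : ℂ → ℂ) ^ (2 * n)) z ≠ 0
        exact pow_ne_zero _ (rhoS_ne_zero hz)
      · simpa [Complex.I_ne_zero] using hξ
      · simpa [Complex.I_ne_zero] using hξ
    · intro k hk hkn
      have hk' := Finset.mem_range.1 hk
      beta_reduce
      rw [ha k (2 * n - k) (by omega), if_neg (by omega)]
      simp
    · intro h
      exact absurd (Finset.mem_range.2 (by omega)) h

/-! ### Cosimilar operators in Hilbert spaces -/

section Hilbert

variable {H K : Type} [NormedAddCommGroup H] [InnerProductSpace ℂ H]
  [NormedAddCommGroup K] [InnerProductSpace ℂ K]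

lemma RankLE.sandwich {R : K →L[ℂ] K} {n : ℕ} (hR : RankLE R n) (A : K →L[ℂ] H) (B : H →L[ℂ] K) :
    RankLE (A ∘L R ∘L B) n :=
  ((LinearMap.rank_comp_le_right ((R ∘L B : H →L[ℂ] K) : H →ₗ[ℂ] K) (A : K →ₗ[ℂ] H)).trans
    (LinearMap.rank_comp_le_left (B : H →ₗ[ℂ] K) (R : K →ₗ[ℂ] K))).trans hR

lemma rankLE_zero (n : ℕ) : RankLE (0 : H →L[ℂ] H) n := by simp [RankLE]

lemma sNumber_nonneg (T : H →L[ℂ] H) (n : ℕ) : 0 ≤ sNumber T n :=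
  Real.iInf_nonneg fun _ => norm_nonneg _

/-- If R has rank at most n, so does A R B; it competes in the infimum for A T B, at distance at
most ‖A‖‖B‖‖T - R‖. -/
lemma sNumber_sandwich_le (T : K →L[ℂ] K) (A : K →L[ℂ] H) (B : H →L[ℂ] K) (n : ℕ) :
    sNumber (A ∘L T ∘L B) n ≤ ‖A‖ * ‖B‖ * sNumber T n := by
  have : Nonempty {R : K →L[ℂ] K // RankLE R n} := ⟨⟨0, rankLE_zero n⟩⟩
  rw [sNumber, sNumber, Real.mul_iInf_of_nonneg (by positivity)]
  refine le_ciInf fun R => ?_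
  refine (ciInf_le ⟨0, ?_⟩ ⟨A ∘L R.1 ∘L B, R.2.sandwich A B⟩).trans ?_
  · rintro _ ⟨S, rfl⟩
    exact norm_nonneg _
  · have h : A ∘L T ∘L B - A ∘L R.1 ∘L B = A ∘L (T - R.1) ∘L B := by
      ext x; simp
    change ‖A ∘L T ∘L B - A ∘L R.1 ∘L B‖ ≤ _
    rw [h]
    calc _ ≤ ‖A‖ * (‖T - R.1‖ * ‖B‖) :=
          (ContinuousLinearMap.opNorm_comp_le _ _).trans
            (mul_le_mul_of_nonneg_left (ContinuousLinearMap.opNorm_comp_le _ _) (norm_nonneg _))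
      _ = _ := by ring

lemma IsSchatten.sandwich {T : K →L[ℂ] K} {p : ℝ} (hp : 0 < p) (hT : IsSchatten p T)
    (A : K →L[ℂ] H) (B : H →L[ℂ] K) : IsSchatten p (A ∘L T ∘L B) := by
  refine Summable.of_nonneg_of_le (fun n => Real.rpow_nonneg (sNumber_nonneg _ n) p) (fun n => ?_)
    (hT.mul_left ((‖A‖ * ‖B‖) ^ p))
  rw [← Real.mul_rpow (by positivity) (sNumber_nonneg _ n)]
  exact Real.rpow_le_rpow (sNumber_nonneg _ n) (sNumber_sandwich_le T A B n) hp.le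

lemma IsFiniteRank.sandwich {T : K →L[ℂ] K} (hT : IsFiniteRank T)
    (A : K →L[ℂ] H) (B : H →L[ℂ] K) : IsFiniteRank (A ∘L T ∘L B) := by
  have : FiniteDimensional ℂ (LinearMap.range (T : K →ₗ[ℂ] K)) := hT
  refine Submodule.finiteDimensional_of_le
    (S₂ := (LinearMap.range (T : K →ₗ[ℂ] K)).map (A : K →ₗ[ℂ] H)) ?_
  rintro _ ⟨x, rfl⟩
  exact ⟨T (B x), ⟨B x, rfl⟩, rfl⟩

/-! ### Forms transported to Hilbert spaces -/

variable {E : Type*} [AddCommGroup E] [Module ℂ E]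

/-- The bounded operator `T` represents the form `b`, transported by `ι`. -/
def Represents (ι : E →ₗ[ℂ] H) (b : E →ₗ⋆[ℂ] E →ₗ[ℂ] ℂ) (T : H →L[ℂ] H) : Prop :=
  ∀ u v, ⟪ι v, T (ι u)⟫_ℂ = b v u

/-- The form `b` is bounded with respect to the norm transported by `ι`. -/
def FormBounded (ι : E →ₗ[ℂ] H) (b : E →ₗ⋆[ℂ] E →ₗ[ℂ] ℂ) : Prop :=
  ∃ C, ∀ u v, ‖b v u‖ ≤ C * ‖ι u‖ * ‖ι v‖

/-- The map `ι₁` is bounded with respect to the norm transported by `ι₂`. -/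
def DominatedBy (ι₁ : E →ₗ[ℂ] H) (ι₂ : E →ₗ[ℂ] K) : Prop := ∃ C, ∀ u, ‖ι₁ u‖ ≤ C * ‖ι₂ u‖

lemma FormBounded.of_dominatedBy {ι₁ : E →ₗ[ℂ] H} {ι₂ : E →ₗ[ℂ] K}
    {b : E →ₗ⋆[ℂ] E →ₗ[ℂ] ℂ} (hb : FormBounded ι₁ b) (h : DominatedBy ι₁ ι₂) :
    FormBounded ι₂ b := by
  obtain ⟨C, hC⟩ := hb
  obtain ⟨D, hD⟩ := h
  have hD' (u : E) : ‖ι₁ u‖ ≤ |D| * ‖ι₂ u‖ :=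
    (hD u).trans (mul_le_mul_of_nonneg_right (le_abs_self D) (norm_nonneg _))
  refine ⟨|C| * |D| * |D|, fun u v => (hC u v).trans ?_⟩
  calc _ ≤ |C| * (|D| * ‖ι₂ u‖) * (|D| * ‖ι₂ v‖) := by
        gcongr
        exacts [le_abs_self C, hD' u, hD' v]
    _ = _ := by ring

/-- No nonzero vector is orthogonal to the range of `ι`. -/
def TotalRange (ι : E →ₗ[ℂ] H) : Prop := ∀ x, (∀ u, ⟪ι u, x⟫_ℂ = 0) → x = 0

variable [CompleteSpace H] [CompleteSpace K]

/-- T₂ = (Z⁻¹)* T₁ Z⁻¹. Thanks to symmetry every equivalence below needs one direction only. -/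
lemma Cosimilar.symm {T₁ : H →L[ℂ] H} {T₂ : K →L[ℂ] K} (h : Cosimilar T₁ T₂) :
    Cosimilar T₂ T₁ := by
  obtain ⟨Z, rfl⟩ := h
  refine ⟨Z.symm, ?_⟩
  refine ContinuousLinearMap.ext fun x => ext_inner_left ℂ fun y => ?_
  simp [ContinuousLinearMap.adjoint_inner_right]

lemma Cosimilar.isCompactOperator {T₁ : H →L[ℂ] H} {T₂ : K →L[ℂ] K} (h : Cosimilar T₁ T₂)
    (hT : IsCompactOperator T₂) : IsCompactOperator T₁ := by
  obtain ⟨Z, rfl⟩ := h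
  exact (hT.comp_clm (Z : H →L[ℂ] K)).clm_comp (ContinuousLinearMap.adjoint (Z : H →L[ℂ] K))

lemma Cosimilar.isSchatten {T₁ : H →L[ℂ] H} {T₂ : K →L[ℂ] K} (h : Cosimilar T₁ T₂)
    {p : ℝ} (hp : 0 < p) (hT : IsSchatten p T₂) : IsSchatten p T₁ := by
  obtain ⟨Z, rfl⟩ := h
  exact hT.sandwich hp _ _

lemma Cosimilar.isFiniteRank {T₁ : H →L[ℂ] H} {T₂ : K →L[ℂ] K} (h : Cosimilar T₁ T₂)
    (hT : IsFiniteRank T₂) : IsFiniteRank T₁ := by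
  obtain ⟨Z, rfl⟩ := h
  exact hT.sandwich _ _

lemma Cosimilar.eq_zero {T₁ : H →L[ℂ] H} {T₂ : K →L[ℂ] K} (h : Cosimilar T₁ T₂)
    (hT : T₂ = 0) : T₁ = 0 := by
  obtain ⟨Z, rfl⟩ := h
  simp [hT]

lemma Cosimilar.properties {T₁ : H →L[ℂ] H} {T₂ : K →L[ℂ] K} (h : Cosimilar T₁ T₂) :
    Cosimilar T₁ T₂ ∧ (IsCompactOperator T₁ ↔ IsCompactOperator T₂) ∧
      (∀ p : ℝ, 0 < p → (IsSchatten p T₁ ↔ IsSchatten p T₂)) ∧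
      (IsFiniteRank T₁ ↔ IsFiniteRank T₂) ∧ (T₁ = 0 ↔ T₂ = 0) :=
  ⟨h, ⟨h.symm.isCompactOperator, h.isCompactOperator⟩,
    fun _ hp => ⟨h.symm.isSchatten hp, h.isSchatten hp⟩,
    ⟨h.symm.isFiniteRank, h.isFiniteRank⟩, ⟨h.symm.eq_zero, h.eq_zero⟩⟩

/-! ### Operators defined by bounded forms on dense subspaces -/

lemma TotalRange.denseRange {ι : E →ₗ[ℂ] H} (h : TotalRange ι) : DenseRange ι := by
  have h1 : (LinearMap.range ι)ᗮ = ⊥ := by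
    refine (Submodule.eq_bot_iff _).2 fun x hx => h x fun u => ?_
    exact (Submodule.mem_orthogonal _ _).1 hx _ ⟨u, rfl⟩
  have h2 := Submodule.dense_iff_topologicalClosure_eq_top.2
    ((Submodule.topologicalClosure_eq_top_iff).2 h1)
  rwa [LinearMap.coe_range] at h2

lemma Represents.unique {ι : E →ₗ[ℂ] H} (hι : TotalRange ι) {b : E →ₗ⋆[ℂ] E →ₗ[ℂ] ℂ}
    {T S : H →L[ℂ] H} (hT : Represents ι b T) (hS : Represents ι b S) : T = S :=
  DFunLike.coe_injective (hι.denseRange.equalizer T.continuous S.continuous (funext fun u =>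
    hι.denseRange.eq_of_inner_right ℂ fun v => (hT u v).trans (hS u v).symm))

/-- The form is extended by continuity first in its linear argument and then in its conjugate-linear
one; the Riesz representation gives the operator. The range of ι is dense, but injectivity of ι is
not needed. -/
lemma exists_represents {ι : E →ₗ[ℂ] H} (hι : DenseRange ι) (b : E →ₗ⋆[ℂ] E →ₗ[ℂ] ℂ) {C : ℝ}
    (hb : ∀ u v, ‖b v u‖ ≤ C * ‖ι u‖ * ‖ι v‖) : ∃ T, Represents ι b T := by
  have hC : ∀ u v, ‖b v u‖ ≤ (|C| * ‖ι v‖) * ‖ι u‖ := fun u v => by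
    refine (hb u v).trans ?_
    rw [mul_right_comm]
    gcongr
    exact le_abs_self C
  have hext (v u : E) : (b v).extendOfNorm ι (ι u) = b v u :=
    LinearMap.extendOfNorm_eq hι ⟨_, fun u => hC u v⟩ u
  have hadd (v w u : E) : (b v + b w).extendOfNorm ι (ι u) = b v u + b w u := by
    simpa using hext (v + w) u
  have hsmul (c : ℂ) (v u : E) : (star c • b v).extendOfNorm ι (ι u) = star c * b v u := by
    simpa using hext (c • v) u
  let B₁ : E →ₗ⋆[ℂ] (H →L[ℂ] ℂ) :=
    { toFun := fun v => (b v).extendOfNorm ι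
      map_add' := fun v w => DFunLike.coe_injective
        (hι.equalizer (ContinuousLinearMap.continuous _) (ContinuousLinearMap.continuous _)
          (funext fun u => by simp [hext, hadd]))
      map_smul' := fun c v => DFunLike.coe_injective
        (hι.equalizer (ContinuousLinearMap.continuous _) (ContinuousLinearMap.continuous _)
          (funext fun u => by simpa [hext] using hsmul c v u)) }
  have hB₁ : ∀ v, ‖B₁ v‖ ≤ |C| * ‖ι v‖ := fun v =>
    LinearMap.opNorm_extendOfNorm_le hι (by positivity) fun u => hC u v
  let B₂ : H →L⋆[ℂ] H →L[ℂ] ℂ := B₁.extendOfNorm ι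
  -- The Riesz operator of the form acts on the conjugate-linear slot, so its adjoint is the
  -- operator sought.
  refine ⟨ContinuousLinearMap.adjoint (InnerProductSpace.continuousLinearMapOfBilin B₂),
    fun u v => ?_⟩
  rw [ContinuousLinearMap.adjoint_inner_right,
    InnerProductSpace.continuousLinearMapOfBilin_apply]
  change B₁.extendOfNorm ι (ι v) (ι u) = _
  rw [LinearMap.extendOfNorm_eq hι ⟨_, hB₁⟩]
  exact hext v u

lemma existsUnique_represents {ι : E →ₗ[ℂ] H} (hι : TotalRange ι) {b : E →ₗ⋆[ℂ] E →ₗ[ℂ] ℂ}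
    (hb : FormBounded ι b) : ∃! T, Represents ι b T := by
  obtain ⟨C, hC⟩ := hb
  obtain ⟨S, hS⟩ := exists_represents hι.denseRange b hC
  exact ⟨S, hS, fun T hT => hT.unique hι hS⟩

theorem cosimilar_of_represents {ι₁ : E →ₗ[ℂ] H} {ι₂ : E →ₗ[ℂ] K} (ht₁ : TotalRange ι₁)
    (ht₂ : TotalRange ι₂) (h₁₂ : DominatedBy ι₁ ι₂) (h₂₁ : DominatedBy ι₂ ι₁)
    {b : E →ₗ⋆[ℂ] E →ₗ[ℂ] ℂ} {T₁ : H →L[ℂ] H} {T₂ : K →L[ℂ] K} (hT₁ : Represents ι₁ b T₁)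
    (hT₂ : Represents ι₂ b T₂) : Cosimilar T₁ T₂ := by
  have h₁ := ht₁.denseRange
  have h₂ := ht₂.denseRange
  let Z : H ≃L[ℂ] K := (LinearEquiv.refl ℂ E).extend ι₁ ι₂ h₁ h₂₁ h₂ h₁₂
  have hZ (u : E) : Z (ι₁ u) = ι₂ u := LinearMap.extendOfNorm_eq h₁ h₂₁ u
  -- Z* T₂ Z represents the same form through ι₁, since Z carries ι₁ u to ι₂ u; uniqueness
  -- identifies it with T₁.
  refine ⟨Z, hT₁.unique ht₁ fun u v => ?_⟩
  simp [ContinuousLinearMap.adjoint_inner_right, hZ, hT₂ u v]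

end Hilbert

/-! ### Integrals over the disk -/

lemma integrable_smooth (f : Smooth) :
    Integrable (f : ℂ → ℂ) ((volume : Measure ℂ).restrict (Metric.ball 0 1)) := by
  have : IsFiniteMeasure ((volume : Measure ℂ).restrict (Metric.ball 0 1)) := ⟨by simp⟩
  exact (memLp_smooth f).integrable (by norm_num)

lemma integrable_L2 (f : L2Disk) :
    Integrable f ((volume : Measure ℂ).restrict (Metric.ball 0 1)) := by
  have : IsFiniteMeasure ((volume : Measure ℂ).restrict (Metric.ball 0 1)) := ⟨by simp⟩
  exact (Lp.memLp f).integrable (by norm_num)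

lemma integrable_L2_mul (f : L2Disk) (u : Smooth) :
    Integrable (fun z => f z * (u : ℂ → ℂ) z)
      ((volume : Measure ℂ).restrict (Metric.ball 0 1)) :=
  MemLp.integrable_mul (Lp.memLp f) (memLp_smooth u)

/-- The integral over the disk. -/
def dInt : Smooth →ₗ[ℂ] ℂ where
  toFun u := ∫ z in Metric.ball (0 : ℂ) 1, (u : ℂ → ℂ) z
  map_add' u v := integral_add (integrable_smooth u) (integrable_smooth v)
  map_smul' c _ := integral_const_mul c _

/-- The bilinear pairing `∫ f u` over the disk. -/
def pairL2 (f : L2Disk) : Smooth →ₗ[ℂ] ℂ where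
  toFun u := ∫ z in Metric.ball (0 : ℂ) 1, f z * (u : ℂ → ℂ) z
  map_add' u v := by
    rw [← integral_add (integrable_L2_mul f u) (integrable_L2_mul f v)]
    exact integral_congr_ae (Filter.Eventually.of_forall fun z => mul_add _ _ _)
  map_smul' c u := by
    rw [RingHom.id_apply, smul_eq_mul, ← integral_const_mul]
    exact integral_congr_ae (Filter.Eventually.of_forall fun z => mul_left_comm _ _ _)

lemma mem_polyBergman {j : ℕ} {f : L2Disk} :
    f ∈ polyBergman j ↔ ∀ φ : 𝓓(disk, ℂ), pairL2 f ((delbar ^ j) (ofTest φ)) = 0 := Iff.rfl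

lemma coeFn_toL2 (u : Smooth) :
    (toL2 u : ℂ → ℂ) =ᵐ[(volume : Measure ℂ).restrict (Metric.ball 0 1)] (u : ℂ → ℂ) :=
  (memLp_smooth u).coeFn_toLp

lemma inner_toL2 (u : Smooth) (f : L2Disk) : ⟪toL2 u, f⟫_ℂ = pairL2 f (conjS u) := by
  rw [L2.inner_def]
  refine integral_congr_ae ?_
  filter_upwards [coeFn_toL2 u] with z hz
  rw [hz, RCLike.inner_apply]
  rfl

lemma pairL2_toL2 (u v : Smooth) : pairL2 (toL2 u) v = dInt (u * v) := by
  refine integral_congr_ae ?_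
  filter_upwards [coeFn_toL2 u] with z hz
  rw [hz]
  rfl

lemma inner_toL2_toL2 (u v : Smooth) : ⟪toL2 u, toL2 v⟫_ℂ = dInt (conjS u * v) := by
  rw [inner_toL2, pairL2_toL2, mul_comm]

lemma dInt_conjS (u : Smooth) : dInt (conjS u) = star (dInt u) := integral_conj

lemma dInt_conjS_mul_self (u : Smooth) : dInt (conjS u * u) = ((‖toL2 u‖ ^ 2 : ℝ) : ℂ) := by
  rw [← inner_toL2_toL2, inner_self_eq_norm_sq_to_K]
  norm_cast

/-- The inclusion of the smooth functions in `L²` as a linear map. -/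
def toL2Lin : Smooth →ₗ[ℂ] L2Disk where
  toFun := toL2
  map_add' u v := MemLp.toLp_add (memLp_smooth u) (memLp_smooth v)
  map_smul' c u := MemLp.toLp_const_smul c (memLp_smooth u)

/-! ### Integration by parts against test functions -/

/-- Smooth functions with compact support in the open disk. -/
def IsTest (u : Smooth) : Prop :=
  HasCompactSupport (u : ℂ → ℂ) ∧ tsupport (u : ℂ → ℂ) ⊆ Metric.ball 0 1

lemma isTest_ofTest (φ : 𝓓(disk, ℂ)) : IsTest (ofTest φ) :=
  ⟨φ.hasCompactSupport', φ.tsupport_subset'⟩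

lemma IsTest.of_support_subset {u v : Smooth} (hu : IsTest u)
    (h : Function.support (v : ℂ → ℂ) ⊆ tsupport (u : ℂ → ℂ)) : IsTest v := by
  have h' := closure_minimal h (isClosed_tsupport _)
  exact ⟨hu.1.of_isClosed_subset (isClosed_tsupport _) h', h'.trans hu.2⟩

lemma IsTest.mul_left {u : Smooth} (hu : IsTest u) (a : Smooth) : IsTest (a * u) :=
  hu.of_support_subset fun z hz => subset_tsupport _ fun h => hz (by
    change (a : ℂ → ℂ) z * (u : ℂ → ℂ) z = 0
    rw [h, mul_zero])

lemma IsTest.dirDeriv {u : Smooth} (hu : IsTest u) (v : ℂ) : IsTest (dirDeriv v u) :=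
  hu.of_support_subset fun z hz => support_fderiv_subset ℝ fun h => hz (by
    change fderiv ℝ (u : ℂ → ℂ) z v = 0
    rw [h]; rfl)

lemma IsTest.delbar {u : Smooth} (hu : IsTest u) : IsTest (delbar u) :=
  hu.of_support_subset fun z hz => by
    by_contra hz'
    have h (v : ℂ) : (PolyBergman.dirDeriv v u : ℂ → ℂ) z = 0 := by
      by_contra h'
      exact hz' (support_fderiv_subset ℝ fun h => h' (by
        change fderiv ℝ (u : ℂ → ℂ) z v = 0
        rw [h]; rfl))
    refine hz ?_
    change (1 / 2 : ℂ) * ((PolyBergman.dirDeriv 1 u : ℂ → ℂ) z +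
      Complex.I * (PolyBergman.dirDeriv Complex.I u : ℂ → ℂ) z) = 0
    rw [h, h]
    ring

/-- The integral extends to the whole plane by the support condition; there, integrate by parts
against the constant 1. -/
lemma dInt_dirDeriv {u : Smooth} (hu : IsTest u) (v : ℂ) : dInt (dirDeriv v u) = 0 := by
  have hv := hu.dirDeriv v
  have h0 : ∫ z in Metric.ball (0 : ℂ) 1, (dirDeriv v u : ℂ → ℂ) z =
      ∫ z, (dirDeriv v u : ℂ → ℂ) z :=
    setIntegral_eq_integral_of_forall_compl_eq_zero fun z hz =>
      image_eq_zero_of_notMem_tsupport fun h => hz (hv.2 h)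
  have hi : Integrable (u : ℂ → ℂ) := (contDiff_smooth u).continuous.integrable_of_hasCompactSupport hu.1
  have hi' : Integrable (dirDeriv v u : ℂ → ℂ) :=
    (contDiff_smooth _).continuous.integrable_of_hasCompactSupport hv.1
  have h1 := integral_mul_fderiv_eq_neg_fderiv_mul_of_integrable (𝕜 := ℂ) (μ := volume) (v := v)
    (f := fun _ : ℂ => (1 : ℂ)) (g := (u : ℂ → ℂ)) (by simp) (by simp only [one_mul]; exact hi')
    (by simpa using hi) (fun _ _ => by fun_prop) (fun z _ => differentiableAt_smooth u z)
  change ∫ z in Metric.ball (0 : ℂ) 1, (dirDeriv v u : ℂ → ℂ) z = 0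
  rw [h0]
  simp only [one_mul, fderiv_fun_const, Pi.zero_apply, zero_apply, zero_mul,
    integral_zero, neg_zero] at h1
  exact h1

lemma dInt_delbar {u : Smooth} (hu : IsTest u) : dInt (delbar u) = 0 := by
  rw [delbar_apply, map_smul, map_add, map_smul, dInt_dirDeriv hu, dInt_dirDeriv hu]
  simp

lemma dInt_mul_delbar (u : Smooth) {φ : Smooth} (hφ : IsTest φ) :
    dInt (u * delbar φ) = -dInt (delbar u * φ) := by
  have h := dInt_delbar (hφ.mul_left u)
  rw [delbar_mul, map_add] at h
  linear_combination h

lemma dInt_mul_delbar_pow (j : ℕ) (u : Smooth) {φ : Smooth} (hφ : IsTest φ) :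
    dInt (u * (delbar ^ j) φ) = (-1) ^ j * dInt ((delbar ^ j) u * φ) := by
  induction j generalizing u φ with
  | zero => simp
  | succ j ih =>
    rw [pow_succ, Module.End.mul_apply, ih u hφ.delbar, dInt_mul_delbar _ hφ,
      ← Module.End.mul_apply delbar, ← pow_succ' delbar, ← pow_succ delbar]
    ring

lemma toL2_mem_polyBergman {j : ℕ} {u : Smooth} (hu : (delbar ^ j) u = 0) :
    toL2 u ∈ polyBergman j := by
  rw [mem_polyBergman]
  intro φ
  rw [pairL2_toL2, dInt_mul_delbar_pow j u (isTest_ofTest φ), hu, zero_mul, map_zero, mul_zero]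

/-! ### Cut-off functions near the boundary -/

/-- Smooth functions on the line that vanish on `(-∞, 1]` and are constant on `[2, ∞)`. -/
def IsCutoff (η : ℝ → ℝ) : Prop :=
  ContDiff ℝ ∞ η ∧ (∀ s ≤ 1, η s = 0) ∧ ∃ c, ∀ s, 2 ≤ s → η s = c

lemma IsCutoff.bounded {η : ℝ → ℝ} (h : IsCutoff η) : ∃ B, ∀ s, ‖η s‖ ≤ B := by
  obtain ⟨hs, h0, c, hc⟩ := h
  obtain ⟨B, hB⟩ := (isCompact_Icc (a := (1 : ℝ)) (b := 2)).exists_bound_of_continuousOn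
    hs.continuous.continuousOn
  refine ⟨max B 0 + ‖c‖, fun s => ?_⟩
  have hc0 := norm_nonneg c
  have hm := le_max_left B 0
  have hm' := le_max_right B 0
  rcases le_or_gt s 1 with h1 | h1
  · rw [h0 s h1, norm_zero]; positivity
  · rcases le_or_gt 2 s with h2 | h2
    · rw [hc s h2]; linarith
    · have := hB s ⟨h1.le, h2.le⟩; linarith

/-- Stability under η ↦ sη' drives the induction on the number of derivatives. This is why the
definition allows an arbitrary constant at infinity: here it becomes 0. -/
lemma IsCutoff.mul_deriv {η : ℝ → ℝ} (h : IsCutoff η) : IsCutoff fun s => s * deriv η s := by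
  obtain ⟨hs, h0, c, hc⟩ := h
  have hd : ContDiff ℝ ∞ (deriv η) := (contDiff_infty_iff_deriv.1 hs).2
  have hcl (s : Set ℝ) (hs' : ∀ t ∈ s, deriv η t = 0) :
      ∀ t ∈ closure s, deriv η t = 0 :=
    fun t ht => closure_minimal (t := {t | deriv η t = 0}) hs'
      (isClosed_eq hd.continuous continuous_const) ht
  refine ⟨contDiff_id.mul hd, fun s hs' => ?_, 0, fun s hs' => ?_⟩
  · beta_reduce
    rw [hcl (Set.Iio 1) (fun t ht => ?_) s (by simpa using hs'), mul_zero]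
    have : η =ᶠ[nhds t] fun _ => 0 := by
      filter_upwards [Iio_mem_nhds ht] with x hx using h0 x (le_of_lt hx)
    rw [this.deriv_eq]; simp
  · beta_reduce
    rw [hcl (Set.Ioi 2) (fun t ht => ?_) s (by simpa using hs'), mul_zero]
    have : η =ᶠ[nhds t] fun _ => c := by
      filter_upwards [Ioi_mem_nhds ht] with x hx using hc x (le_of_lt hx)
    rw [this.deriv_eq]; simp

lemma contDiff_one_sub_norm_sq : ContDiff ℝ ∞ fun z : ℂ => 1 - ‖z‖ ^ 2 :=
  contDiff_const.sub (contDiff_norm_sq ℝ)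

/-- The function `η(n (1 - |z|²))`. -/
def cutS (η : ℝ → ℝ) (hη : ContDiff ℝ ∞ η) (n : ℕ) : Smooth :=
  ⟨fun z => ((η (n * (1 - ‖z‖ ^ 2)) : ℝ) : ℂ), Complex.ofRealCLM.contDiff.comp
    (hη.comp (contDiff_const.mul contDiff_one_sub_norm_sq))⟩

lemma cutS_apply {η : ℝ → ℝ} (hη : ContDiff ℝ ∞ η) (n : ℕ) (z : ℂ) :
    (cutS η hη n : ℂ → ℂ) z = ((η (n * (1 - ‖z‖ ^ 2)) : ℝ) : ℂ) := rfl

lemma rhoS_apply' (z : ℂ) : (rhoS : ℂ → ℂ) z = ((1 - ‖z‖ ^ 2 : ℝ) : ℂ) := by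
  rw [rhoS_apply]; push_cast; rfl

lemma dirDeriv_cutS {η : ℝ → ℝ} (hη : ContDiff ℝ ∞ η) (n : ℕ) (v z : ℂ) :
    (dirDeriv v (cutS η hη n) : ℂ → ℂ) z =
      ((deriv η (n * (1 - ‖z‖ ^ 2)) : ℝ) : ℂ) * n * (dirDeriv v rhoS : ℂ → ℂ) z := by
  have hr : HasFDerivAt (fun z : ℂ => 1 - ‖z‖ ^ 2) (fderiv ℝ (fun z : ℂ => 1 - ‖z‖ ^ 2) z) z :=
    (contDiff_one_sub_norm_sq.differentiable (by simp) z).hasFDerivAt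
  have h1 : (rhoS : ℂ → ℂ) = fun z => Complex.ofRealCLM (1 - ‖z‖ ^ 2) := funext rhoS_apply'
  have h2 : (dirDeriv v rhoS : ℂ → ℂ) z =
      ((fderiv ℝ (fun z : ℂ => 1 - ‖z‖ ^ 2) z v : ℝ) : ℂ) := by
    change fderiv ℝ (rhoS : ℂ → ℂ) z v = _
    rw [h1]
    exact congrArg (fun L => L v) (Complex.ofRealCLM.hasFDerivAt.comp z hr).fderiv
  have h3 : HasDerivAt η (deriv η (n * (1 - ‖z‖ ^ 2))) (n * (1 - ‖z‖ ^ 2)) :=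
    (hη.differentiable (by simp) _).hasDerivAt
  have h4 := Complex.ofRealCLM.hasFDerivAt.comp z
    (h3.comp_hasFDerivAt z (hr.const_mul (n : ℝ)))
  rw [h2]
  change fderiv ℝ (fun z => Complex.ofRealCLM (η (n * (1 - ‖z‖ ^ 2)))) z v = _
  have h5 := congrArg (fun L => L v) h4.fderiv
  refine h5.trans ?_
  simp [mul_assoc]

/-- Differentiating η(nρ) costs a factor n, but n ρ η'(nρ) is the cut-off of sη' at nρ, so one
factor ρ absorbs the loss. -/
lemma delbar_cutS_mul_rhoS {η : ℝ → ℝ} (hη : IsCutoff η) (n : ℕ) :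
    delbar (cutS η hη.1 n) * rhoS = -zS * cutS _ hη.mul_deriv.1 n := by
  refine smooth_ext fun z => ?_
  have h1 : (delbar (cutS η hη.1 n) : ℂ → ℂ) z =
      ((deriv η (n * (1 - ‖z‖ ^ 2)) : ℝ) : ℂ) * n * (delbar rhoS : ℂ → ℂ) z := by
    change (1 / 2 : ℂ) * ((dirDeriv 1 _ : ℂ → ℂ) z + Complex.I * (dirDeriv Complex.I _ : ℂ → ℂ) z) =
      _ * _ * ((1 / 2 : ℂ) *
        ((dirDeriv 1 _ : ℂ → ℂ) z + Complex.I * (dirDeriv Complex.I _ : ℂ → ℂ) z))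
    rw [dirDeriv_cutS, dirDeriv_cutS]
    ring
  have h2 : (delbar rhoS : ℂ → ℂ) z = -z := by rw [delbar_rhoS]; rfl
  change (delbar (cutS η hη.1 n) : ℂ → ℂ) z * (rhoS : ℂ → ℂ) z =
    -z * (cutS _ hη.mul_deriv.1 n : ℂ → ℂ) z
  rw [h1, h2, cutS_apply, rhoS_apply']
  push_cast
  ring

lemma exists_bound_smooth (q : Smooth) :
    ∃ B, ∀ z ∈ Metric.ball (0 : ℂ) 1, ‖(q : ℂ → ℂ) z‖ ≤ B := by
  obtain ⟨B, hB⟩ := (isCompact_closedBall (0 : ℂ) 1).exists_bound_of_continuousOn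
    (contDiff_smooth q).continuous.continuousOn
  exact ⟨B, fun z hz => hB z (Metric.ball_subset_closedBall hz)⟩

/-- The point is uniformity in n. Each ∂̄ uses up one factor ρ, either on the cut-off or by
differentiating the power itself, and otherwise leaves a spare ρ in the smooth factor; m factors
suffice for m derivatives. -/
lemma exists_bound_delbar_pow_cutS (m : ℕ) {η : ℝ → ℝ} (hη : IsCutoff η) (q : Smooth) :
    ∃ B, ∀ n, ∀ z ∈ Metric.ball (0 : ℂ) 1,
      ‖((delbar ^ m) (cutS η hη.1 n * (rhoS ^ m * q)) : ℂ → ℂ) z‖ ≤ B := by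
  induction m generalizing η q with
  | zero =>
    obtain ⟨B, hB⟩ := hη.bounded
    obtain ⟨B', hB'⟩ := exists_bound_smooth q
    refine ⟨B * B', fun n z hz => ?_⟩
    simp only [pow_zero, one_mul, Module.End.one_apply]
    change ‖(cutS η hη.1 n : ℂ → ℂ) z * (q : ℂ → ℂ) z‖ ≤ _
    rw [norm_mul, cutS_apply, Complex.norm_real]
    exact mul_le_mul (hB _) (hB' z hz) (norm_nonneg _) ((norm_nonneg _).trans (hB 0))
  | succ m ih =>
    obtain ⟨B, hB⟩ := ih hη.mul_deriv (-zS * q)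
    obtain ⟨B', hB'⟩ := ih hη (-(((m : Smooth) + 1) * zS * q) + rhoS * delbar q)
    refine ⟨B + B', fun n z hz => ?_⟩
    have h : delbar (cutS η hη.1 n * (rhoS ^ (m + 1) * q)) =
        cutS _ hη.mul_deriv.1 n * (rhoS ^ m * (-zS * q)) +
          cutS η hη.1 n * (rhoS ^ m * (-(((m : Smooth) + 1) * zS * q) + rhoS * delbar q)) := by
      have h0 := delbar_cutS_mul_rhoS hη n
      rw [delbar_mul, delbar_mul, delbar_pow_succ, delbar_rhoS]
      linear_combination rhoS ^ m * q * h0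
    rw [pow_succ, Module.End.mul_apply, h, map_add]
    exact (norm_add_le _ _).trans (add_le_add (hB n z hz) (hB' n z hz))

lemma isTest_cutS_mul {η : ℝ → ℝ} (hη : IsCutoff η) (n : ℕ) (q : Smooth) :
    IsTest (cutS η hη.1 n * q) := by
  have hcl : IsClosed {z : ℂ | 1 ≤ n * (1 - ‖z‖ ^ 2)} :=
    isClosed_le continuous_const (by fun_prop)
  have hsub : {z : ℂ | 1 ≤ n * (1 - ‖z‖ ^ 2)} ⊆ Metric.ball 0 1 := by
    intro z hz
    have hz : 1 ≤ (n : ℝ) * (1 - ‖z‖ ^ 2) := hz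
    rw [mem_ball_zero_iff]
    by_contra! h
    have h1 : (1 : ℝ) - ‖z‖ ^ 2 ≤ 0 := by nlinarith
    have := mul_nonpos_of_nonneg_of_nonpos (Nat.cast_nonneg (α := ℝ) n) h1
    linarith
  have hsupp : tsupport (cutS η hη.1 n * q : ℂ → ℂ) ⊆ {z : ℂ | 1 ≤ n * (1 - ‖z‖ ^ 2)} := by
    refine closure_minimal (fun z hz => ?_) hcl
    by_contra h
    refine hz ?_
    change (cutS η hη.1 n : ℂ → ℂ) z * (q : ℂ → ℂ) z = 0
    rw [cutS_apply, hη.2.1 _ (le_of_lt (not_le.1 h))]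
    simp
  exact ⟨(isCompact_closedBall (0 : ℂ) 1).of_isClosed_subset (isClosed_tsupport _)
    ((hsupp.trans hsub).trans Metric.ball_subset_closedBall), hsupp.trans hsub⟩

lemma delbar_pow_eventuallyEq (m : ℕ) {u v : Smooth} {z : ℂ}
    (h : (u : ℂ → ℂ) =ᶠ[nhds z] (v : ℂ → ℂ)) :
    ((delbar ^ m) u : ℂ → ℂ) =ᶠ[nhds z] ((delbar ^ m) v : ℂ → ℂ) := by
  induction m with
  | zero => exact h
  | succ m ih =>
    rw [pow_succ', Module.End.mul_apply, Module.End.mul_apply]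
    filter_upwards [ih.fderiv (𝕜 := ℝ)] with w hw
    change (1 / 2 : ℂ) * (fderiv ℝ _ w 1 + Complex.I * fderiv ℝ _ w Complex.I) =
      (1 / 2 : ℂ) * (fderiv ℝ _ w 1 + Complex.I * fderiv ℝ _ w Complex.I)
    rw [hw]

lemma isCutoff_smoothTransition : IsCutoff fun s => Real.smoothTransition (s - 1) :=
  ⟨Real.smoothTransition.contDiff.comp (contDiff_id.sub contDiff_const),
    fun s hs => Real.smoothTransition.zero_of_nonpos (by linarith),
    1, fun s hs => Real.smoothTransition.one_of_one_le (by linarith)⟩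

/-- The defining equation of `A_j` holds for functions that only vanish to order `j` at the
boundary. -/
theorem pairL2_delbar_pow_rhoS_pow {j : ℕ} {f : L2Disk} (hf : f ∈ polyBergman j) (q : Smooth) :
    pairL2 f ((delbar ^ j) (rhoS ^ j * q)) = 0 := by
  have hη := isCutoff_smoothTransition
  obtain ⟨B, hB⟩ := exists_bound_delbar_pow_cutS j hη q
  have hzero (n : ℕ) : pairL2 f ((delbar ^ j) (cutS _ hη.1 n * (rhoS ^ j * q))) = 0 := by
    have ht := isTest_cutS_mul hη n (rhoS ^ j * q)
    exact mem_polyBergman.1 hf ⟨_, contDiff_smooth (cutS _ hη.1 n * (rhoS ^ j * q)), ht.1, ht.2⟩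
  -- Dominated convergence with majorant B|f|. At a fixed z, once nρ(z) > 2 the cut-off is 1 near z,
  -- so the integrands eventually agree with the limit.
  have hlim : Filter.Tendsto
      (fun n : ℕ => pairL2 f ((delbar ^ j) (cutS _ hη.1 n * (rhoS ^ j * q)))) Filter.atTop
      (nhds (pairL2 f ((delbar ^ j) (rhoS ^ j * q)))) := by
    refine tendsto_integral_of_dominated_convergence (fun z => ‖f z‖ * B)
      (fun n => (integrable_L2_mul f _).aestronglyMeasurable)
      ((integrable_L2 f).norm.mul_const B) (fun n => ?_) ?_
    · filter_upwards [ae_restrict_mem measurableSet_ball] with z hz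
      rw [norm_mul]
      exact mul_le_mul_of_nonneg_left (hB n z hz) (norm_nonneg _)
    · filter_upwards [ae_restrict_mem measurableSet_ball] with z hz
      have hz1 : 0 < 1 - ‖z‖ ^ 2 := by
        have : ‖z‖ < 1 := by simpa using hz
        nlinarith [norm_nonneg z]
      obtain ⟨N, hN⟩ := exists_nat_gt (2 / (1 - ‖z‖ ^ 2))
      refine tendsto_const_nhds.congr' ?_
      filter_upwards [Filter.eventually_ge_atTop N] with n hn
      have hn2 : 2 < (n : ℝ) * (1 - ‖z‖ ^ 2) := by
        rw [← div_lt_iff₀ hz1]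
        exact hN.trans_le (by exact_mod_cast hn)
      have hloc : (rhoS ^ j * q : Smooth) =ᶠ[nhds z]
          ((cutS _ hη.1 n * (rhoS ^ j * q) : Smooth) : ℂ → ℂ) := by
        have hc : Continuous fun w : ℂ => (n : ℝ) * (1 - ‖w‖ ^ 2) := by fun_prop
        filter_upwards [hc.continuousAt.eventually (Ioi_mem_nhds hn2)] with w (hw : 2 < _)
        change _ = (cutS _ hη.1 n : ℂ → ℂ) w * ((rhoS ^ j * q : Smooth) : ℂ → ℂ) w
        rw [cutS_apply, Real.smoothTransition.one_of_one_le (by linarith)]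
        simp
      rw [(delbar_pow_eventuallyEq j hloc).eq_of_nhds]
  exact tendsto_nhds_unique hlim (by simp only [hzero]; exact tendsto_const_nhds)

/-! ### Integration by parts on the disk -/

/-- Stokes without boundary term, because ρ vanishes on the circle; obtained by applying the
preceding theorem to the constant 1 in A_1. -/
lemma dInt_delbar_rhoS_mul (h : Smooth) : dInt (delbar (rhoS * h)) = 0 := by
  have h1 : toL2 1 ∈ polyBergman 1 := toL2_mem_polyBergman (by simpa using delbar_one)
  simpa [pairL2_toL2] using pairL2_delbar_pow_rhoS_pow h1 h

lemma dInt_del_rhoS_mul (h : Smooth) : dInt (del (rhoS * h)) = 0 := by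
  have h1 := congrArg star (dInt_delbar_rhoS_mul (conjS h))
  rwa [← dInt_conjS, conjS_delbar, conjS_mul, conjS_conjS, conjS_rhoS, star_zero] at h1

lemma dInt_delbar_pow_rhoS_pow_mul (j : ℕ) (q u : Smooth) :
    dInt ((delbar ^ j) (rhoS ^ j * q) * u) = (-1) ^ j * dInt (rhoS ^ j * q * (delbar ^ j) u) := by
  induction j generalizing q with
  | zero => simp
  | succ j ih =>
    have h : delbar (rhoS ^ (j + 1) * q) =
        rhoS ^ j * (-(((j : Smooth) + 1) * zS * q) + rhoS * delbar q) := by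
      rw [delbar_mul, delbar_pow_succ, delbar_rhoS]
      ring
    have h0 := dInt_delbar_rhoS_mul (rhoS ^ j * q * (delbar ^ j) u)
    rw [← mul_assoc, ← mul_assoc, ← pow_succ', delbar_mul, map_add, ← Module.End.mul_apply delbar,
      ← pow_succ' delbar, h] at h0
    rw [pow_succ delbar, Module.End.mul_apply, h, ih, ← pow_succ delbar, pow_succ (-1 : ℂ)]
    linear_combination (-1) ^ j * h0

lemma dInt_del_pow_rhoS_pow_mul (j : ℕ) (q u : Smooth) :
    dInt ((del ^ j) (rhoS ^ j * q) * u) = (-1) ^ j * dInt (rhoS ^ j * q * (del ^ j) u) := by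
  have h (v : Smooth) : conjS ((delbar ^ j) (conjS v)) = (del ^ j) v := by
    rw [← conjS_del_pow, conjS_conjS]
  have h1 := congrArg star (dInt_delbar_pow_rhoS_pow_mul j (conjS q) (conjS u))
  have h2 : rhoS ^ j * conjS q = conjS (rhoS ^ j * q) := by
    rw [conjS_mul, conjS_pow, conjS_rhoS]
  rw [h2, ← dInt_conjS, conjS_mul, h, conjS_conjS, star_mul', ← dInt_conjS, conjS_mul, h,
    conjS_conjS, star_pow, star_neg, star_one] at h1
  exact h1

/-! ### The norm of `Σ_j f` -/

lemma delbar_mul_of_delbar_eq_zero {f g : Smooth} (hf : delbar f = 0) (hg : delbar g = 0) :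
    delbar (f * g) = 0 := by
  rw [delbar_mul, hf, hg, zero_mul, mul_zero, add_zero]

lemma delbar_pow_natCast_mul (m n : ℕ) (f : Smooth) :
    (delbar ^ m) ((n : Smooth) * f) = n * (delbar ^ m) f := by
  rw [← nsmul_eq_mul, map_nsmul, nsmul_eq_mul]

/-- With f holomorphic, each ∂̄ hits only the remaining power ρ^k and replaces it by -k z ρ^{k-1}.
-/
lemma delbar_pow_rhoS_pow_mul (j : ℕ) {f : Smooth} (hf : delbar f = 0) :
    (delbar ^ j) (rhoS ^ j * f) = (-1) ^ j * (j.factorial : Smooth) * (zS ^ j * f) := by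
  induction j generalizing f with
  | zero => simp
  | succ j ih =>
    have h : delbar (rhoS ^ (j + 1) * f) = -(((j + 1 : ℕ) : Smooth) * (rhoS ^ j * (zS * f))) := by
      rw [delbar_mul, delbar_pow_succ, delbar_rhoS, hf]
      push_cast
      ring
    rw [pow_succ, Module.End.mul_apply, h, map_neg, delbar_pow_natCast_mul,
      ih (delbar_mul_of_delbar_eq_zero delbar_zS hf), Nat.factorial_succ]
    push_cast
    ring

lemma del_pow_rhoS_pow_mul_conjS (j : ℕ) {f : Smooth} (hf : delbar f = 0) :
    (del ^ j) (rhoS ^ j * conjS f) =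
      (-1) ^ j * (j.factorial : Smooth) * (conjS (zS ^ j * f)) := by
  have h := congrArg conjS (delbar_pow_rhoS_pow_mul j hf)
  rw [← conjS_conjS (rhoS ^ j * f), ← conjS_del_pow, conjS_conjS, conjS_mul, conjS_mul, conjS_mul,
    conjS_pow, conjS_pow, conjS_natCast, conjS_neg, conjS_one, conjS_rhoS] at h
  exact h

lemma delbar_pow_del_pow (j : ℕ) (f : Smooth) :
    (delbar ^ j) ((del ^ j) f) = (del ^ j) ((delbar ^ j) f) := by
  rw [← Module.End.mul_apply, ← Module.End.mul_apply,
    ((commute_del_delbar.pow_left j).pow_right j).eq]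

lemma smooth_neg_one_pow_mul_natCast (j n : ℕ) (f : Smooth) :
    (-1) ^ j * (n : Smooth) * f = ((-1) ^ j * (n : ℂ)) • f := by
  rw [Algebra.smul_def, map_mul, map_pow, map_neg, map_one, map_natCast]

lemma conjS_sigmaOp (j : ℕ) (f : Smooth) :
    conjS (sigmaOp j f) = (delbar ^ j) (rhoS ^ j * conjS f) := by
  rw [sigmaOp_apply, conjS_del_pow, conjS_mul, conjS_pow, conjS_rhoS]

/-- Move ∂̄^j from conj(Σ_j f) onto Σ_j f, where ∂̄^j(ρ^j f) collapses to (-1)^j j! z^j f; then move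
the remaining ∂^j back onto ρ^j f̄, which collapses to the conjugate expression. The signs cancel.
-/
lemma norm_toL2_sigmaOp (j : ℕ) {f : Smooth} (hf : delbar f = 0) :
    ‖toL2 (sigmaOp j f)‖ = j.factorial * ‖toL2 (zS ^ j * f)‖ := by
  have h1 : dInt (conjS (sigmaOp j f) * sigmaOp j f) =
      (j.factorial : ℂ) ^ 2 * dInt (conjS (zS ^ j * f) * (zS ^ j * f)) := by
    have hs : ((-1 : ℂ) ^ j) ^ 2 = 1 := by rw [← pow_mul, mul_comm, pow_mul]; simp
    have h3 := dInt_del_pow_rhoS_pow_mul j (conjS f) (zS ^ j * f)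
    rw [del_pow_rhoS_pow_mul_conjS j hf, smooth_neg_one_pow_mul_natCast, smul_mul_assoc,
      map_smul, smul_eq_mul] at h3
    rw [conjS_sigmaOp, dInt_delbar_pow_rhoS_pow_mul, sigmaOp_apply, delbar_pow_del_pow,
      delbar_pow_rhoS_pow_mul j hf, smooth_neg_one_pow_mul_natCast, map_smul, mul_smul_comm,
      map_smul, smul_eq_mul]
    linear_combination (-(j.factorial : ℂ) * (-1) ^ j) * h3 +
      ((j.factorial : ℂ) ^ 2 * dInt (conjS (zS ^ j * f) * (zS ^ j * f))) * hs
  rw [dInt_conjS_mul_self, dInt_conjS_mul_self] at h1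
  have h2 : ‖toL2 (sigmaOp j f)‖ ^ 2 = (j.factorial * ‖toL2 (zS ^ j * f)‖) ^ 2 := by
    rw [mul_pow]
    exact_mod_cast h1
  exact (sq_eq_sq₀ (norm_nonneg _) (by positivity)).1 h2

lemma norm_toL2_zS_mul_le (f : Smooth) : ‖toL2 (zS * f)‖ ≤ ‖toL2 f‖ := by
  refine Lp.norm_le_norm_of_ae_le ?_
  filter_upwards [coeFn_toL2 (zS * f), coeFn_toL2 f, ae_restrict_mem measurableSet_ball]
    with z h1 h2 hz
  rw [h1, h2]
  change ‖z * (f : ℂ → ℂ) z‖ ≤ _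
  rw [norm_mul]
  have : ‖z‖ < 1 := by simpa using hz
  exact mul_le_of_le_one_left (norm_nonneg _) this.le

/-- Integrating ∂̄(ρ z̄ |f|²) and ∂(ρ² f conj(∂f)) and eliminating the common mixed term gives 2‖f‖²
+ ‖ρ∂f‖² = 4‖zf‖². -/
lemma norm_toL2_sq_le_zS_mul {f : Smooth} (hf : delbar f = 0) :
    ‖toL2 f‖ ^ 2 ≤ 2 * ‖toL2 (zS * f)‖ ^ 2 := by
  have ha := dInt_delbar_rhoS_mul (conjS zS * (f * conjS f))
  have hb := dInt_del_rhoS_mul (rhoS * (f * conjS (del f)))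
  have hd : delbar (del f) = 0 := by
    have := delbar_del_pow 1 f
    simpa [hf] using this
  have ea : delbar (rhoS * (conjS zS * (f * conjS f))) =
      conjS f * f - (2 : ℂ) • (conjS (zS * f) * (zS * f)) +
        rhoS * conjS zS * f * conjS (del f) := by
    simp only [delbar_mul, delbar_rhoS, delbar_conjS_zS, hf, conjS_del, conjS_mul, two_smul]
    have hr : rhoS = 1 - zS * conjS zS := rfl
    rw [hr]
    ring
  have eb : del (rhoS * (rhoS * (f * conjS (del f)))) =
      conjS (rhoS * del f) * (rhoS * del f) - (2 : ℂ) • (rhoS * conjS zS * f * conjS (del f)) := by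
    simp only [del_mul, del_rhoS, ← conjS_delbar, hd, conjS_zero, conjS_mul, conjS_rhoS, two_smul]
    ring
  rw [ea, map_add, map_sub, map_smul, dInt_conjS_mul_self, dInt_conjS_mul_self] at ha
  rw [eb, map_sub, map_smul, dInt_conjS_mul_self] at hb
  have hc : ((2 * ‖toL2 f‖ ^ 2 + ‖toL2 (rhoS * del f)‖ ^ 2 : ℝ) : ℂ) =
      ((4 * ‖toL2 (zS * f)‖ ^ 2 : ℝ) : ℂ) := by
    simp only [smul_eq_mul] at ha hb
    push_cast at ha hb ⊢
    linear_combination 2 * ha + hb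
  have hc' : 2 * ‖toL2 f‖ ^ 2 + ‖toL2 (rhoS * del f)‖ ^ 2 = 4 * ‖toL2 (zS * f)‖ ^ 2 :=
    Complex.ofReal_injective hc
  nlinarith [sq_nonneg ‖toL2 (rhoS * del f)‖]

lemma norm_toL2_zS_pow_mul_le (j : ℕ) (f : Smooth) : ‖toL2 (zS ^ j * f)‖ ≤ ‖toL2 f‖ := by
  induction j with
  | zero => simp
  | succ j ih =>
    rw [pow_succ', mul_assoc]
    exact (norm_toL2_zS_mul_le _).trans ih

lemma norm_toL2_sq_le_zS_pow_mul (j : ℕ) {f : Smooth} (hf : delbar f = 0) :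
    ‖toL2 f‖ ^ 2 ≤ 2 ^ j * ‖toL2 (zS ^ j * f)‖ ^ 2 := by
  induction j with
  | zero => simp
  | succ j ih =>
    have h := norm_toL2_sq_le_zS_mul (delbar_mul_of_delbar_eq_zero
      (delbar_pow_of_delbar_eq_zero delbar_zS j) hf)
    rw [← mul_assoc, ← pow_succ'] at h
    calc _ ≤ 2 ^ j * ‖toL2 (zS ^ j * f)‖ ^ 2 := ih
      _ ≤ 2 ^ j * (2 * ‖toL2 (zS ^ (j + 1) * f)‖ ^ 2) := by gcongr
      _ = _ := by ring

lemma norm_toL2_sigmaOp_le (j : ℕ) {f : Smooth} (hf : delbar f = 0) :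
    ‖toL2 (sigmaOp j f)‖ ≤ j.factorial * ‖toL2 f‖ := by
  rw [norm_toL2_sigmaOp j hf]
  exact mul_le_mul_of_nonneg_left (norm_toL2_zS_pow_mul_le j f) (Nat.cast_nonneg _)

/-- The factor 2^j is a crude replacement for 2^{j/2}/j!. -/
lemma norm_toL2_le_sigmaOp (j : ℕ) {f : Smooth} (hf : delbar f = 0) :
    ‖toL2 f‖ ≤ 2 ^ j * ‖toL2 (sigmaOp j f)‖ := by
  have h1 : ‖toL2 (zS ^ j * f)‖ ≤ ‖toL2 (sigmaOp j f)‖ := by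
    rw [norm_toL2_sigmaOp j hf]
    exact le_mul_of_one_le_left (norm_nonneg _) (by exact_mod_cast j.factorial_pos)
  have h2 : ‖toL2 f‖ ^ 2 ≤ (2 ^ j * ‖toL2 (sigmaOp j f)‖) ^ 2 := by
    calc _ ≤ 2 ^ j * ‖toL2 (zS ^ j * f)‖ ^ 2 := norm_toL2_sq_le_zS_pow_mul j hf
      _ ≤ (2 ^ j) ^ 2 * ‖toL2 (sigmaOp j f)‖ ^ 2 := by
        gcongr
        exact le_self_pow₀ (one_le_pow₀ (by norm_num)) (by norm_num)
      _ = _ := by ring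
  exact (sq_le_sq₀ (norm_nonneg _) (by positivity)).1 h2

/-! ### Completeness of the monomials -/

/-- The monomial `zᵇ z̄ᵃ`. -/
def mono (b a : ℕ) : Smooth := zS ^ b * conjS zS ^ a

lemma mono_mul_mono (a b c d : ℕ) : mono a b * mono c d = mono (a + c) (b + d) := by
  simp only [mono]; ring

lemma conjS_mono (a b : ℕ) : conjS (mono a b) = mono b a := by
  simp only [mono, conjS_mul, conjS_pow, conjS_conjS, mul_comm]

/-- Polynomials in `z` and `z̄`. -/
def polySpan : Submodule ℂ Smooth := Submodule.span ℂ (Set.range fun p : ℕ × ℕ => mono p.1 p.2)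

lemma mono_mem_polySpan (b a : ℕ) : mono b a ∈ polySpan := Submodule.subset_span ⟨(b, a), rfl⟩

lemma mul_mem_polySpan {p q : Smooth} (hp : p ∈ polySpan) (hq : q ∈ polySpan) :
    p * q ∈ polySpan := by
  have h := Submodule.mul_mem_mul hp hq
  rw [polySpan, Submodule.span_mul_span] at h
  refine Submodule.span_mono ?_ h
  rintro _ ⟨_, ⟨x, rfl⟩, _, ⟨y, rfl⟩, rfl⟩
  exact ⟨(x.1 + y.1, x.2 + y.2), (mono_mul_mono _ _ _ _).symm⟩

lemma conjS_mem_polySpan {p : Smooth} (hp : p ∈ polySpan) : conjS p ∈ polySpan := by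
  induction hp using Submodule.span_induction with
  | mem x hx =>
    obtain ⟨y, rfl⟩ := hx
    rw [conjS_mono]
    exact mono_mem_polySpan _ _
  | zero => rw [conjS_zero]; exact zero_mem _
  | add x y _ _ hx hy => rw [conjS_add]; exact add_mem hx hy
  | smul c x _ hx => rw [conjS_smul]; exact Submodule.smul_mem _ _ hx

/-- Stone–Weierstrass on the closed disk: the star algebra generated by the coordinate consists of
polynomials in z and z̄. -/
lemma exists_polySpan_approx {g : ℂ → ℂ} (hg : Continuous g) {ε : ℝ} (hε : 0 < ε) :
    ∃ q ∈ polySpan, ∀ z ∈ Metric.closedBall (0 : ℂ) 1, ‖g z - (q : ℂ → ℂ) z‖ < ε := by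
  have hK : CompactSpace (Metric.closedBall (0 : ℂ) 1) :=
    isCompact_iff_compactSpace.1 (isCompact_closedBall 0 1)
  have hp : ∀ p ∈ (polynomialFunctions (Metric.closedBall (0 : ℂ) 1)).starClosure,
      ∃ q ∈ polySpan, ∀ z, p z = (q : ℂ → ℂ) z := by
    intro p hp
    rw [polynomialFunctions.starClosure_eq_adjoin_X] at hp
    induction hp using StarAlgebra.adjoin_induction with
    | mem x hx =>
      obtain rfl := hx
      refine ⟨mono 1 0, mono_mem_polySpan _ _, fun z => ?_⟩
      have : mono 1 0 = zS := by simp [mono]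
      rw [this]
      simp [zS]
    | algebraMap c =>
      refine ⟨c • mono 0 0, Submodule.smul_mem _ _ (mono_mem_polySpan _ _), fun z => ?_⟩
      have : mono 0 0 = 1 := by simp [mono]
      rw [this]
      change c = c * 1
      rw [mul_one]
    | add x y _ _ hx hy =>
      obtain ⟨q, hq, hq'⟩ := hx
      obtain ⟨r, hr, hr'⟩ := hy
      exact ⟨q + r, add_mem hq hr, fun z => congrArg₂ (· + ·) (hq' z) (hr' z)⟩
    | mul x y _ _ hx hy =>
      obtain ⟨q, hq, hq'⟩ := hx
      obtain ⟨r, hr, hr'⟩ := hy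
      exact ⟨q * r, mul_mem_polySpan hq hr, fun z => congrArg₂ (· * ·) (hq' z) (hr' z)⟩
    | star x _ hx =>
      obtain ⟨q, hq, hq'⟩ := hx
      exact ⟨conjS q, conjS_mem_polySpan hq, fun z => congrArg star (hq' z)⟩
  let g' : C(Metric.closedBall (0 : ℂ) 1, ℂ) := ⟨fun z => g z, by fun_prop⟩
  have hmem : g' ∈ (polynomialFunctions (Metric.closedBall (0 : ℂ) 1)).starClosure.topologicalClosure := by
    rw [polynomialFunctions.starClosure_topologicalClosure]
    trivial
  obtain ⟨p, hpm, hpε⟩ := Metric.mem_closure_iff.1 hmem ε hε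
  obtain ⟨q, hq, hq'⟩ := hp p hpm
  refine ⟨q, hq, fun z hz => ?_⟩
  rw [← hq' ⟨z, hz⟩, ← dist_eq_norm]
  exact (ContinuousMap.dist_apply_le_dist (f := g') (g := p) ⟨z, hz⟩).trans_lt hpε

lemma eq_zero_of_pairL2_mono {f : L2Disk} (h : ∀ b a, pairL2 f (mono b a) = 0) : f = 0 := by
  have hq : ∀ q ∈ polySpan, pairL2 f q = 0 := by
    have : polySpan ≤ LinearMap.ker (pairL2 f) := by
      refine Submodule.span_le.2 ?_
      rintro _ ⟨p, rfl⟩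
      exact h _ _
    exact fun q hq => this hq
  have hg : ∀ g : ℂ → ℂ, Continuous g → ∫ z in Metric.ball (0 : ℂ) 1, f z * g z = 0 := by
    intro g hg
    obtain ⟨B, hB⟩ := (isCompact_closedBall (0 : ℂ) 1).exists_bound_of_continuousOn hg.continuousOn
    have hfg : Integrable (fun z => f z * g z) ((volume : Measure ℂ).restrict (Metric.ball 0 1)) := by
      refine (integrable_L2 f).mul_bdd (c := B) hg.aestronglyMeasurable ?_
      filter_upwards [ae_restrict_mem measurableSet_ball] with z hz
      exact hB z (Metric.ball_subset_closedBall hz)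
    have hle : ∀ ε > 0, ‖∫ z in Metric.ball (0 : ℂ) 1, f z * g z‖ ≤
        ε * ∫ z in Metric.ball (0 : ℂ) 1, ‖f z‖ := by
      intro ε hε
      obtain ⟨q, hqm, hqε⟩ := exists_polySpan_approx hg hε
      have h1 : ∫ z in Metric.ball (0 : ℂ) 1, f z * g z =
          ∫ z in Metric.ball (0 : ℂ) 1, (f z * g z - f z * (q : ℂ → ℂ) z) := by
        rw [integral_sub hfg (integrable_L2_mul f q)]
        exact (sub_eq_self.2 (hq q hqm)).symm
      rw [h1, ← integral_const_mul]
      refine norm_integral_le_of_norm_le ((integrable_L2 f).norm.const_mul ε) ?_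
      filter_upwards [ae_restrict_mem measurableSet_ball] with z hz
      rw [← mul_sub, norm_mul, mul_comm]
      exact mul_le_mul_of_nonneg_right (hqε z (Metric.ball_subset_closedBall hz)).le (norm_nonneg _)
    have hI : 0 ≤ ∫ z in Metric.ball (0 : ℂ) 1, ‖f z‖ := integral_nonneg fun _ => norm_nonneg _
    refine norm_eq_zero.1 (le_antisymm (le_of_forall_pos_le_add fun δ hδ => ?_) (norm_nonneg _))
    -- The 1 in the denominator keeps the quotient meaningful when the integral of |f| is zero.
    refine (hle (δ / (1 + ∫ z in Metric.ball (0 : ℂ) 1, ‖f z‖)) (by positivity)).trans ?_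
    rw [zero_add, div_mul_eq_mul_div, div_le_iff₀ (by positivity)]
    nlinarith
  refine (Lp.eq_zero_iff_ae_eq_zero).2 ?_
  refine ae_eq_zero_of_integral_contDiff_smul_eq_zero (integrable_L2 f).locallyIntegrable
    fun g hgs _ => ?_
  refine (integral_congr_ae (Filter.Eventually.of_forall fun z => ?_)).trans
    (hg (fun z => (g z : ℂ)) (by have := hgs.continuous; fun_prop))
  change (g z : ℝ) • f z = f z * (g z : ℂ)
  rw [Complex.real_smul, mul_comm]

/-! ### Density in the poly-Bergman spaces -/

/-- Polynomials in `z` and `z̄` of degree less than `B` in `z`. -/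
def monoLT (B : ℕ) : Submodule ℂ Smooth :=
  Submodule.span ℂ {u | ∃ b a, b < B ∧ u = mono b a}

lemma mono_mem_monoLT {b B : ℕ} (h : b < B) (a : ℕ) : mono b a ∈ monoLT B :=
  Submodule.subset_span ⟨b, a, h, rfl⟩

lemma monoLT_mono {B B' : ℕ} (h : B ≤ B') : monoLT B ≤ monoLT B' := by
  refine Submodule.span_mono ?_
  rintro _ ⟨b, a, hb, rfl⟩
  exact ⟨b, a, by omega, rfl⟩

lemma delbar_mono (b a : ℕ) : delbar (mono b a) = (a : Smooth) * mono b (a - 1) := by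
  cases a with
  | zero => simp [mono, delbar_pow_of_delbar_eq_zero delbar_zS]
  | succ a =>
    rw [mono, delbar_mul, delbar_pow_of_delbar_eq_zero delbar_zS, delbar_pow_succ, delbar_conjS_zS,
      Nat.add_sub_cancel, mono]
    push_cast
    ring

lemma delbar_pow_mono_eq_zero {j a : ℕ} (h : a < j) (b : ℕ) : (delbar ^ j) (mono b a) = 0 := by
  induction j generalizing a with
  | zero => omega
  | succ j ih =>
    rw [pow_succ, Module.End.mul_apply, delbar_mono, delbar_pow_natCast_mul]
    rcases Nat.eq_zero_or_pos a with rfl | ha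
    · simp
    · rw [ih (by omega), mul_zero]

/-- Expanding one ρ as 1 - z z̄ in the term a ρ^{n+1} z^b z̄^{a-1} makes it join the derivative of
ρ^{n+1}. A power of ρ is traded for a power of z, up to a term of lower degree in z. -/
lemma delbar_rhoS_pow_succ_mul_mono (n b a : ℕ) : delbar (rhoS ^ (n + 1) * mono b a) =
    -(((n + 1 + a : ℕ) : Smooth) * (rhoS ^ n * mono (b + 1) a)) +
      (a : Smooth) * (rhoS ^ n * mono b (a - 1)) := by
  rw [delbar_mul, delbar_mono, delbar_pow_succ, delbar_rhoS]
  have hr : (a : Smooth) * (rhoS * mono b (a - 1)) =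
      (a : Smooth) * mono b (a - 1) - (a : Smooth) * mono (b + 1) a := by
    cases a with
    | zero => simp
    | succ a =>
      rw [Nat.add_sub_cancel]
      have hr : rhoS = 1 - zS * conjS zS := rfl
      simp only [mono, hr]
      ring
  have hm : mono (b + 1) a = zS * mono b a := by simp only [mono]; ring
  rw [hm] at hr ⊢
  push_cast
  linear_combination rhoS ^ n * hr

lemma exists_top_coeff (j b a : ℕ) : ∃ c : ℂ, c ≠ 0 ∧
    (delbar ^ j) (rhoS ^ j * mono b a) - c • mono (b + j) a ∈ monoLT (b + j) := by
  induction j generalizing b a with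
  | zero => exact ⟨1, one_ne_zero, by simp⟩
  | succ j ih =>
    obtain ⟨c, hc, h⟩ := ih (b + 1) a
    obtain ⟨c', -, h'⟩ := ih b (a - 1)
    -- The leading coefficient gains the factor -(j+1+a) at each step, so it never vanishes.
    refine ⟨-((j + 1 + a : ℕ) : ℂ) * c, mul_ne_zero (neg_ne_zero.2 (Nat.cast_ne_zero.2 (by omega))) hc, ?_⟩
    have h2 : (delbar ^ j) (rhoS ^ j * mono b (a - 1)) ∈ monoLT (b + (j + 1)) := by
      rw [← sub_add_cancel ((delbar ^ j) (rhoS ^ j * mono b (a - 1))) (c' • mono (b + j) (a - 1))]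
      exact add_mem (monoLT_mono (by omega) h')
        (Submodule.smul_mem _ _ (mono_mem_monoLT (by omega) _))
    have e : b + 1 + j = b + (j + 1) := by omega
    rw [e] at h
    have h3 := add_mem (Submodule.smul_mem _ (-((j + 1 + a : ℕ) : ℂ)) h)
      (Submodule.smul_mem _ (a : ℂ) h2)
    convert h3 using 1
    have hs (n : ℕ) (u : Smooth) : (n : Smooth) * u = (n : ℂ) • u := by
      rw [Algebra.smul_def, map_natCast]
    rw [pow_succ, Module.End.mul_apply, delbar_rhoS_pow_succ_mul_mono, map_add, map_neg,
      delbar_pow_natCast_mul, delbar_pow_natCast_mul, hs, hs]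
    module

/-- If `f` annihilates the polynomials of degree less than `b + j` in `z` and the function
`∂̄ʲ(ρʲ zᵇ z̄ᵃ)`, then it annihilates `z^(b+j) z̄ᵃ`. -/
lemma pairL2_mono_eq_zero {f : L2Disk} {j b a : ℕ}
    (hf : pairL2 f ((delbar ^ j) (rhoS ^ j * mono b a)) = 0)
    (h : ∀ b' < b + j, ∀ a', pairL2 f (mono b' a') = 0) : pairL2 f (mono (b + j) a) = 0 := by
  obtain ⟨c, hc, hm⟩ := exists_top_coeff j b a
  have hle : monoLT (b + j) ≤ LinearMap.ker (pairL2 f) := by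
    refine Submodule.span_le.2 ?_
    rintro _ ⟨b', a', hb', rfl⟩
    exact h b' hb' a'
  have h1 := LinearMap.mem_ker.1 (hle hm)
  rw [map_sub, hf, map_smul, zero_sub, neg_eq_zero, smul_eq_mul] at h1
  exact (mul_eq_zero.1 h1).resolve_left hc

/-- Strong induction on the degree in z yields all moments, and the monomials z^b z̄^a are complete
in L². -/
lemma eq_zero_of_mem_polyBergman {j : ℕ} {f : L2Disk} (hf : f ∈ polyBergman j)
    (h : ∀ b < j, ∀ a, pairL2 f (mono b a) = 0) : f = 0 := by
  refine eq_zero_of_pairL2_mono fun b => ?_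
  induction b using Nat.strong_induction_on with
  | _ b ih =>
    intro a
    rcases lt_or_ge b j with hb | hb
    · exact h b hb a
    · obtain ⟨b', rfl⟩ := Nat.exists_eq_add_of_le' hb
      exact pairL2_mono_eq_zero (pairL2_delbar_pow_rhoS_pow hf _) ih

/-! ### The two maps from polynomials into the Bergman spaces -/

lemma toL2_mem_bergman {f : Smooth} (hf : delbar f = 0) : toL2 f ∈ bergman :=
  toL2_mem_polyBergman (by simpa using hf)

/-- ∂̄^j Σ_j f is a multiple of ∂^j(z^j f), which one more ∂̄ annihilates. Orthogonality to A_j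
holds because conj(Σ_j f) = ∂̄^j(ρ^j f̄) has the form that elements of A_j annihilate. -/
lemma toL2_sigmaOp_mem (j : ℕ) {f : Smooth} (hf : delbar f = 0) :
    toL2 (sigmaOp j f) ∈ trueBergmanSucc j := by
  refine ⟨toL2_mem_polyBergman ?_, (Submodule.mem_orthogonal' _ _).2 fun g hg => ?_⟩
  · rw [pow_succ', Module.End.mul_apply, sigmaOp_apply, delbar_pow_del_pow, delbar_del_pow,
      delbar_pow_rhoS_pow_mul j hf, smooth_neg_one_pow_mul_natCast, map_smul,
      delbar_mul_of_delbar_eq_zero (delbar_pow_of_delbar_eq_zero delbar_zS j) hf, smul_zero,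
      map_zero]
  · rw [inner_toL2, conjS_sigmaOp]
    exact pairL2_delbar_pow_rhoS_pow hg _

/-- The inclusion of the polynomials in the Bergman space. -/
def bergmanIncl : basisSpan →ₗ[ℂ] bergman :=
  (toL2Lin ∘ₗ basisSpan.subtype).codRestrict bergman
    fun f => toL2_mem_bergman (delbar_basisSpan f.2)

/-- The map `Σ_j` from the polynomials to the true poly-Bergman space. -/
def sigmaIncl (j : ℕ) : basisSpan →ₗ[ℂ] trueBergmanSucc j :=
  (toL2Lin ∘ₗ sigmaOp j ∘ₗ basisSpan.subtype).codRestrict (trueBergmanSucc j)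
    fun f => toL2_sigmaOp_mem j (delbar_basisSpan f.2)

lemma coe_bergmanIncl (f : basisSpan) : (bergmanIncl f : L2Disk) = toL2 f := rfl

lemma coe_sigmaIncl (j : ℕ) (f : basisSpan) :
    (sigmaIncl j f : L2Disk) = toL2 (sigmaOp j f) := rfl

lemma zS_pow_mem_basisSpan (k : ℕ) : zS ^ k ∈ basisSpan := by
  have h : ((√((k + 1) / Real.pi) : ℝ) : ℂ) ≠ 0 := by
    have : 0 < √((k + 1) / Real.pi) := by positivity
    exact_mod_cast this.ne'
  have h2 := basisSpan.smul_mem ((√((k + 1) / Real.pi) : ℝ) : ℂ)⁻¹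
    (Submodule.subset_span ⟨k, rfl⟩ : basisFn k ∈ basisSpan)
  rwa [basisFn, smul_smul, inv_mul_cancel₀ h, one_smul] at h2

lemma totalRange_bergmanIncl : TotalRange (E := basisSpan) (H := bergman) bergmanIncl := by
  refine fun x hx => Subtype.ext ?_
  refine eq_zero_of_mem_polyBergman x.2 fun b hb a => ?_
  have h := hx ⟨_, zS_pow_mem_basisSpan a⟩
  rw [Submodule.coe_inner, coe_bergmanIncl, inner_toL2, conjS_pow] at h
  obtain rfl : b = 0 := by omega
  simpa [mono] using h

lemma totalRange_sigmaIncl (j : ℕ) :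
    TotalRange (E := basisSpan) (H := trueBergmanSucc j) (sigmaIncl j) := by
  refine fun x hx => Subtype.ext ?_
  have hlow : ∀ b < j, ∀ a, pairL2 (x : L2Disk) (mono b a) = 0 := by
    intro b hb a
    have h := (Submodule.mem_orthogonal _ _).1 x.2.2 (toL2 (mono a b))
      (toL2_mem_polyBergman (delbar_pow_mono_eq_zero hb a))
    rwa [inner_toL2, conjS_mono] at h
  refine eq_zero_of_mem_polyBergman x.2.1 fun b hb a => ?_
  rcases lt_or_ge b j with hb' | hb'
  · exact hlow b hb' a
  · have h := hx ⟨_, zS_pow_mem_basisSpan a⟩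
    rw [Submodule.coe_inner, coe_sigmaIncl, inner_toL2, conjS_sigmaOp, conjS_pow] at h
    have h2 : pairL2 (x : L2Disk) ((delbar ^ j) (rhoS ^ j * mono 0 a)) = 0 := by
      simpa [mono] using h
    -- This is the elimination of the leading monomial at b = 0, where conj(Σ_j z^a) has leading
    -- term a multiple of z^j z̄^a.
    have h3 := pairL2_mono_eq_zero h2 (by simpa using hlow)
    obtain rfl : b = j := by omega
    simpa using h3

/-! ### Toeplitz operators as operators representing forms -/

/-- The form `(f, g) ↦ (F, f ḡ)` on the polynomials. -/
def pairForm (F : DiskDist) : basisSpan →ₗ⋆[ℂ] basisSpan →ₗ[ℂ] ℂ :=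
  LinearMap.mk₂'ₛₗ (starRingEnd ℂ) (RingHom.id ℂ)
    (fun v u => pair F ((u : Smooth) * conjS (v : Smooth)))
    (fun v w u => by
      rw [Submodule.coe_add, conjS_add, mul_add, pair_right_add])
    (fun c v u => by
      rw [Submodule.coe_smul, conjS_smul, mul_smul_comm, pair_right_smul]; rfl)
    (fun v u w => by
      rw [Submodule.coe_add, add_mul, pair_right_add])
    (fun c v u => by
      rw [Submodule.coe_smul, smul_mul_assoc, pair_right_smul]; rfl)

lemma pairForm_apply (F : DiskDist) (v u : basisSpan) :
    pairForm F v u = pair F ((u : Smooth) * conjS (v : Smooth)) := rfl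

lemma isToeplitz_bergman_iff (G : DiskDist) (T : bergman →L[ℂ] bergman) :
    IsToeplitz bergman basisSpan G T ↔ Represents (E := basisSpan) bergmanIncl (pairForm G) T := by
  constructor
  · intro h u v
    obtain ⟨U, V, hU, hV, h⟩ := h u u.2 v v.2
    obtain rfl : U = bergmanIncl u := Subtype.ext hU
    obtain rfl : V = bergmanIncl v := Subtype.ext hV
    exact h
  · intro h u hu v hv
    exact ⟨bergmanIncl ⟨u, hu⟩, bergmanIncl ⟨v, hv⟩, rfl, rfl, h ⟨u, hu⟩ ⟨v, hv⟩⟩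

lemma isToeplitz_trueBergman_iff {j : ℕ} {F G : DiskDist}
    (hFG : ∀ f ∈ basisSpan, ∀ g ∈ basisSpan,
      pair F (sigmaOp j f * conjS (sigmaOp j g)) = pair G (f * conjS g))
    (T : trueBergmanSucc j →L[ℂ] trueBergmanSucc j) :
    IsToeplitz (trueBergmanSucc j) (sigmaSpan j) F T ↔
      Represents (E := basisSpan) (sigmaIncl j) (pairForm G) T := by
  constructor
  · intro h u v
    obtain ⟨U, V, hU, hV, h⟩ := h _ ⟨u, u.2, rfl⟩ _ ⟨v, v.2, rfl⟩
    obtain rfl : U = sigmaIncl j u := Subtype.ext hU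
    obtain rfl : V = sigmaIncl j v := Subtype.ext hV
    rw [h, hFG _ u.2 _ v.2, pairForm_apply]
  · rintro h _ ⟨u, hu, rfl⟩ _ ⟨v, hv, rfl⟩
    refine ⟨sigmaIncl j ⟨u, hu⟩, sigmaIncl j ⟨v, hv⟩, rfl, rfl, ?_⟩
    rw [h ⟨u, hu⟩ ⟨v, hv⟩, hFG u hu v hv, pairForm_apply]

lemma dominatedBy_sigmaIncl (j : ℕ) :
    DominatedBy (E := basisSpan) (H := trueBergmanSucc j) (K := bergman)
      (sigmaIncl j) bergmanIncl :=
  ⟨j.factorial, fun u => norm_toL2_sigmaOp_le j (delbar_basisSpan u.2)⟩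

lemma dominatedBy_bergmanIncl (j : ℕ) :
    DominatedBy (E := basisSpan) (H := bergman) (K := trueBergmanSucc j)
      bergmanIncl (sigmaIncl j) :=
  ⟨2 ^ j, fun u => norm_toL2_le_sigmaOp j (delbar_basisSpan u.2)⟩

lemma ToeplitzBounded.formBounded_bergman {G : DiskDist} (h : ToeplitzBounded basisSpan G) :
    FormBounded (E := basisSpan) (H := bergman) bergmanIncl (pairForm G) := by
  obtain ⟨C, hC⟩ := h
  exact ⟨C, fun u v => hC _ u.2 _ v.2⟩

lemma ToeplitzBounded.formBounded_trueBergman {j : ℕ} {F G : DiskDist}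
    (hFG : ∀ f ∈ basisSpan, ∀ g ∈ basisSpan,
      pair F (sigmaOp j f * conjS (sigmaOp j g)) = pair G (f * conjS g))
    (h : ToeplitzBounded (sigmaSpan j) F) :
    FormBounded (E := basisSpan) (H := trueBergmanSucc j) (sigmaIncl j) (pairForm G) := by
  obtain ⟨C, hC⟩ := h
  refine ⟨C, fun u v => ?_⟩
  have := hC _ ⟨u, u.2, rfl⟩ _ ⟨v, v.2, rfl⟩
  rwa [hFG _ u.2 _ v.2] at this

end

end PolyBergman

/-! ### The main theorem -/

open PolyBergman
theorem mainTheorem2 (j : ℕ) :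
    ∃ P : NCPoly,
      HasDegree P j ∧
      (∀ w ∈ P.support, weight w = 0) ∧
      IsEllipticOfOrder (2 * j) (evalOp P) ∧
      ∀ F : DiskDist,
        (∀ f ∈ basisSpan, ∀ g ∈ basisSpan,
          pair F (sigmaOp j f * conjS (sigmaOp j g)) = pair (evalOp P F) (f * conjS g)) ∧
        ((ToeplitzBounded (sigmaSpan j) F ∨ ToeplitzBounded basisSpan (evalOp P F)) →
          (∃! T₁ : trueBergmanSucc j →L[ℂ] trueBergmanSucc j,
            IsToeplitz (trueBergmanSucc j) (sigmaSpan j) F T₁) ∧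
          (∃! T₂ : bergman →L[ℂ] bergman,
            IsToeplitz bergman basisSpan (evalOp P F) T₂) ∧
          ∀ (T₁ : trueBergmanSucc j →L[ℂ] trueBergmanSucc j) (T₂ : bergman →L[ℂ] bergman),
            IsToeplitz (trueBergmanSucc j) (sigmaSpan j) F T₁ →
            IsToeplitz bergman basisSpan (evalOp P F) T₂ →
            Cosimilar T₁ T₂ ∧
            (IsCompactOperator T₁ ↔ IsCompactOperator T₂) ∧
            (∀ p : ℝ, 0 < p → (IsSchatten p T₁ ↔ IsSchatten p T₂)) ∧
            (IsFiniteRank T₁ ↔ IsFiniteRank T₂) ∧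
            (T₁ = 0 ↔ T₂ = 0)) := by
  refine ⟨symbolPoly j, hasDegree_symbolPoly j, fun w _ => weight_eq_zero w,
    isEllipticOfOrder_symbolPoly j, fun F => ?_⟩
  have hpair : ∀ f ∈ basisSpan, ∀ g ∈ basisSpan,
      pair F (sigmaOp j f * conjS (sigmaOp j g)) = pair (evalOp (symbolPoly j) F) (f * conjS g) :=
    fun f hf g hg => pair_sigmaOp_mul_conjS j (delbar_basisSpan hf) (delbar_basisSpan hg) F
  refine ⟨hpair, fun hbdd => ?_⟩
  have hiff₁ := isToeplitz_trueBergman_iff hpair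
  have hiff₂ := isToeplitz_bergman_iff (evalOp (symbolPoly j) F)
  -- Whichever operator is bounded, the common form is bounded in the Bergman norm, and then, by
  -- equivalence of norms, also in the norm transported by Σ_j.
  have hb₂ := hbdd.elim
    (fun h => (h.formBounded_trueBergman hpair).of_dominatedBy (dominatedBy_sigmaIncl j))
    (fun h => h.formBounded_bergman)
  have hb₁ := hb₂.of_dominatedBy (dominatedBy_bergmanIncl j)
  obtain ⟨S₁, hS₁, hu₁⟩ := existsUnique_represents (totalRange_sigmaIncl j) hb₁
  obtain ⟨S₂, hS₂, hu₂⟩ := existsUnique_represents totalRange_bergmanIncl hb₂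
  refine ⟨⟨S₁, (hiff₁ S₁).2 hS₁, fun T hT => hu₁ T ((hiff₁ T).1 hT)⟩,
    ⟨S₂, (hiff₂ S₂).2 hS₂, fun T hT => hu₂ T ((hiff₂ T).1 hT)⟩, fun T₁ T₂ hT₁ hT₂ => ?_⟩
  exact (cosimilar_of_represents (totalRange_sigmaIncl j) totalRange_bergmanIncl
    (dominatedBy_sigmaIncl j) (dominatedBy_bergmanIncl j)
    ((hiff₁ T₁).1 hT₁) ((hiff₂ T₂).1 hT₂)).properties
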